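/- Fix $q\in[1,\infty)$ and write $\|\cdot\|$ for the $\ell_q$ norm on $\mathbb{R}^d$. For $\beta,L>0$ let $\beta_0:=\lceil\beta\rceil-1$, and for an open set $U\subseteq\mathbb{R}^d$ let $\mathcal{H}(\beta,L)$ on $U$ be the set of $\beta_0$-times differentiable functions $f$ on $U$ such that $\sup_U|\partial^\alpha f|\le L$ whenever $\|\alpha\|_1\le\beta_0$, and $|\partial^\alpha f(x)-\partial^\alpha f(y)|\le L\|x-y\|^{\beta-\beta_0}$ for $x,y\in U$ whenever $\|\alpha\|_1=\beta_0$. Regression model. Let $(X_1,Y_1),\dots,(X_n,Y_n)$ be independent copies of $(X,Y)$ with $Y=f(X)+\varepsilon$, $X\sim P_X$ on $\mathbb{R}^d$, $\varepsilon\mid X=x\sim P_{\varepsilon|x}$ and $\mathbb{E}(\varepsilon\mid X)=0$. Let $\mathcal{X}\subseteq\mathbb{R}^d$ be compact with open neighbourhood $\mathcal{X}^\circ$, let $x_0\in\mathcal{X}$, and assume the following. (i) On $\mathcal{X}^\circ$, $P_X$ has a Lebesgue density $p_X\in\mathcal{H}(\beta_X,L_X)$ for some $\beta_X,L_X>0$,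 with $0<c_X\le p_X\le C_X$ on $\mathcal{X}^\circ$. (ii) For each $x\in\mathcal{X}^\circ$, $P_{\varepsilon|x}$ has a positive differentiable density $p(\cdot\mid x)$ whose score $\rho(e\mid x)=p'(e\mid x)/p(e\mid x)$ is differentiable in $e$, with $\sup_{e\in\mathbb{R},\,x\in\mathcal{X}^\circ}|\rho'(e+t\mid x)-\rho'(e\mid x)|\to0$ as $t\to0$; and the Fisher information $i_P(x):=\mathbb{E}\{\rho^2(\varepsilon\mid X)\mid X=x\}$ is finite and uniformly continuous on $\mathcal{X}^\circ$. (iii) There are $C_1,C_2,c_1,C_3,c_3,\delta,\epsilon>0$ such that for $P_X$-almost every $x\in\mathcal{X}^\circ$: $\sup_{|\tau|\le\epsilon}\mathbb{E}\{|\rho(\varepsilon+\tau\mid X)|^{2+\delta}\mid X=x\}\le C_1$, $\sup_{|\tau|\le\epsilon}\mathbb{E}\{\rho'(\varepsilon+\tau\mid X)^2\mid X=x\}\le C_2$, $i_P(x)\ge c_1$, $\mathbb{E}(\varepsilon^2\mid X=x)\ge c_3$ and $\mathbb{E}(|\varepsilon|^{2+\delta}\mid X=x)\le C_3$. For an estimator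 $\hat f_n$ based on $n$ observations, put $$\mathrm{MSE}_n(\hat f_n):=\sup_{f}\ \mathbb{E}\bigl\{n^{2\beta/(2\beta+d)}\bigl(\hat f_n(x_0)-f(x_0)\bigr)^2\bigr\},$$ the supremum being over measurable $f:\mathbb{R}^d\to\mathbb{R}$ that belong to $\mathcal{H}(\beta,L)$ on $\mathcal{X}^\circ$. For $\beta\in(0,1]$ and $d\in\mathbb{N}=\{1,2,\dots\}$ let $$C_{\beta,d}:=\biggl\{\frac{d^{d}(\beta+d)^{2\beta}}{(2^d\beta)^{2\beta}(2\beta+d)^{d}}\cdot\frac{\Gamma^{2\beta}(1+d/q)}{\Gamma^{2\beta d}(1+1/q)}\biggr\}^{1/(2\beta+d)}$$ (the constant in the asymptotic upper bound on the worst-case normalised mean squared error of the outrigger estimator). Theorem. There are constants $c_{\beta,d}>0$ ($\beta>0$, $d\in\mathbb{N}$), depending only on $(\beta,d)$ (and on the fixed $q$), such that for all $\beta,L>0$, all $d\in\mathbb{N}$, every $\mathcal{X},\mathcal{X}^\circ,x_0,P_X,P_{\varepsilon|X}$ as above and every sequence $(\hat f_n)_{n\in\mathbb{N}}$ of Borel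 measurable estimators, $$\liminf_{n\to\infty}\mathrm{MSE}_n(\hat f_n)\ \ge\ c_{\beta,d}\biggl(\frac{L^{d/\beta}}{p_X(x_0)\,i_P(x_0)}\biggr)^{2\beta/(2\beta+d)},$$ and moreover $$1=\lim_{\beta\searrow0}\ \sup_{d\in\mathbb{N}}\frac{C_{\beta,d}}{c_{\beta,d}}\ \le\ \sup_{\beta\in(0,1]}\ \sup_{d\in\mathbb{N}}\frac{C_{\beta,d}}{c_{\beta,d}}\ \le\ 1.69 .$$ -/

import Mathlib

open MeasureTheory ProbabilityTheory Filter Topology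
open scoped ENNReal

noncomputable section

/-- The `ℓ_q` norm on `ℝ^d`. -/
def lqNorm {d : ℕ} (q : ℝ) (x : Fin d → ℝ) : ℝ :=
  (∑ i, |x i| ^ q) ^ (1 / q)

/-- The integer `β₀ = ⌈β⌉ - 1`, used for `β > 0`; thus `β - β₀ ∈ (0, 1]`. -/
def holderOrder (β : ℝ) : ℕ := ⌈β⌉₊ - 1

/-- The mixed partial derivative `∂^k f / ∂x_{j 0} ⋯ ∂x_{j (k-1)}` at `x`.  As `j` ranges over all
maps `Fin k → Fin d`, these are exactly the partial derivatives `∂^α f` with `‖α‖₁ = k`. -/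
def mixedPartial {d k : ℕ} (j : Fin k → Fin d) (f : (Fin d → ℝ) → ℝ) (x : Fin d → ℝ) : ℝ :=
  iteratedFDeriv ℝ k f x (fun i => Pi.single (j i) (1 : ℝ))

/-- The Hölder class `𝓗(β, L)` on an open set `U ⊆ ℝ^d`, with respect to the `ℓ_q` norm.  The values
of the functions outside `U` are unrestricted.  (A `β₀`-times differentiable function whose partial
derivatives of order `β₀` are Hölder continuous is of class `C^{β₀}`.) -/
def HolderClass {d : ℕ} (q β L : ℝ) (U : Set (Fin d → ℝ)) : Set ((Fin d → ℝ) → ℝ) :=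
  {f | ContDiffOn ℝ (holderOrder β : ℕ) f U ∧
    (∀ k ≤ holderOrder β, ∀ j : Fin k → Fin d, ∀ x ∈ U, |mixedPartial j f x| ≤ L) ∧
    (∀ j : Fin (holderOrder β) → Fin d, ∀ x ∈ U, ∀ y ∈ U,
      |mixedPartial j f x - mixedPartial j f y| ≤
        L * lqNorm q (x - y) ^ (β - (holderOrder β : ℝ)))}

/-- The conditional score `ρ(e | x) = p'(e | x) / p(e | x)` of a conditional density
`p x e = p(e | x)`; the derivative is with respect to `e`. -/
def condScore {d : ℕ} (p : (Fin d → ℝ) → ℝ → ℝ) (x : Fin d → ℝ) (e : ℝ) : ℝ :=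
  deriv (p x) e / p x e

/-- The conditional Fisher information `i_P(x) = 𝔼(ρ²(ε | X) | X = x)`. -/
def condFisher {d : ℕ} (κ : Kernel (Fin d → ℝ) ℝ) (p : (Fin d → ℝ) → ℝ → ℝ)
    (x : Fin d → ℝ) : ℝ :=
  ∫ e, condScore p x e ^ 2 ∂(κ x)

/-- Regularity of the covariate distribution `PX` (with density `pX` on `U`) and of the conditional
error distributions `κ x = P_{ε|x}` (with Lebesgue densities `p x` for `x ∈ U`), where `U` is an open
neighbourhood of the compact set `X`. -/
structure RegularModel {d : ℕ} (q : ℝ) (X U : Set (Fin d → ℝ)) (PX : Measure (Fin d → ℝ))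
    (pX : (Fin d → ℝ) → ℝ) (κ : Kernel (Fin d → ℝ) ℝ) (p : (Fin d → ℝ) → ℝ → ℝ) : Prop where
  isCompact : IsCompact X
  isOpen : IsOpen U
  subset : X ⊆ U
  isProb : IsProbabilityMeasure PX
  isMarkov : IsMarkovKernel κ
  /-- `pX` is a density of `PX` on `U`. -/
  covariate_density :
    PX.restrict U = (volume.restrict U).withDensity (fun x => ENNReal.ofReal (pX x))
  covariate_holder : ∃ βX LX : ℝ, 0 < βX ∧ 0 < LX ∧ pX ∈ HolderClass q βX LX U
  covariate_bounds : ∃ cX CX : ℝ, 0 < cX ∧ ∀ x ∈ U, cX ≤ pX x ∧ pX x ≤ CX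
  /-- `𝔼(ε | X) = 0`. -/
  error_mean : ∀ᵐ x ∂PX, Integrable (fun e : ℝ => e) (κ x) ∧ ∫ e, e ∂(κ x) = 0
  error_density : ∀ x ∈ U, κ x = volume.withDensity (fun e => ENNReal.ofReal (p x e))
  /-- The score is well defined on `ℝ × U`. -/
  error_density_pos : ∀ x ∈ U, ∀ e, 0 < p x e
  error_density_diff : ∀ x ∈ U, Differentiable ℝ (p x)
  score_diff : ∀ x ∈ U, Differentiable ℝ (condScore p x)
  score_deriv_uniform : ∀ η > 0, ∃ δ > 0, ∀ t : ℝ, |t| < δ → ∀ x ∈ U, ∀ e : ℝ,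
    |deriv (condScore p x) (e + t) - deriv (condScore p x) e| ≤ η
  fisher_finite : ∀ x ∈ U, Integrable (fun e => condScore p x e ^ 2) (κ x)
  fisher_uniform : UniformContinuousOn (condFisher κ p) U
  moments : ∃ C₁ C₂ c₁ C₃ c₃ δ ε₀ : ℝ,
    0 < C₁ ∧ 0 < C₂ ∧ 0 < c₁ ∧ 0 < C₃ ∧ 0 < c₃ ∧ 0 < δ ∧ 0 < ε₀ ∧
    ∀ᵐ x ∂PX, x ∈ U →
      (∀ τ : ℝ, |τ| ≤ ε₀ →
        ∫⁻ e, ENNReal.ofReal (|condScore p x (e + τ)| ^ (2 + δ)) ∂(κ x) ≤ ENNReal.ofReal C₁) ∧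
      (∀ τ : ℝ, |τ| ≤ ε₀ →
        ∫⁻ e, ENNReal.ofReal (deriv (condScore p x) (e + τ) ^ 2) ∂(κ x) ≤ ENNReal.ofReal C₂) ∧
      c₁ ≤ condFisher κ p x ∧
      ENNReal.ofReal c₃ ≤ ∫⁻ e, ENNReal.ofReal (e ^ 2) ∂(κ x) ∧
      ∫⁻ e, ENNReal.ofReal (|e| ^ (2 + δ)) ∂(κ x) ≤ ENNReal.ofReal C₃

/-- The joint law of `(X, Y)` where `X ∼ PX`, `ε | X ∼ κ X` and `Y = f(X) + ε`. -/
def regressionLaw {d : ℕ} (PX : Measure (Fin d → ℝ)) (κ : Kernel (Fin d → ℝ) ℝ)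
    (f : (Fin d → ℝ) → ℝ) : Measure ((Fin d → ℝ) × ℝ) :=
  (PX ⊗ₘ κ).map (fun z => (z.1, f z.1 + z.2))

/-- An estimator of a regression function on `ℝ^d` from `n` observations: a map from data sets to
functions. -/
abbrev RegressionEstimator (d n : ℕ) : Type :=
  (Fin n → (Fin d → ℝ) × ℝ) → (Fin d → ℝ) → ℝ

/-- The worst-case normalised mean squared error at `x₀` of an estimator based on `n` independent
observations; the supremum is over measurable regression functions `f : ℝ^d → ℝ` that belong to
`𝓗(β, L)` on `U`. -/
def worstCaseMSE {d : ℕ} (q β L : ℝ) (U : Set (Fin d → ℝ)) (PX : Measure (Fin d → ℝ))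
    (κ : Kernel (Fin d → ℝ) ℝ) (x₀ : Fin d → ℝ) (n : ℕ) (fhat : RegressionEstimator d n) : ℝ≥0∞ :=
  ⨆ f ∈ {f : (Fin d → ℝ) → ℝ | Measurable f ∧ f ∈ HolderClass q β L U},
    ∫⁻ D, ENNReal.ofReal ((n : ℝ) ^ (2 * β / (2 * β + d)) * (fhat D x₀ - f x₀) ^ 2)
      ∂(Measure.pi (fun _ : Fin n => regressionLaw PX κ f))

/-- The constant `C_{β,d}` of the upper bound for the outrigger estimator in the range
`β ∈ (0, 1]` (for the fixed `ℓ_q` norm). -/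
def upperConst (q β : ℝ) (d : ℕ) : ℝ :=
  ((d : ℝ) ^ d * (β + d) ^ (2 * β) / (((2 : ℝ) ^ d * β) ^ (2 * β) * (2 * β + d) ^ d) *
    (Real.Gamma (1 + d / q) ^ (2 * β) / Real.Gamma (1 + 1 / q) ^ (2 * β * d))) ^ (1 / (2 * β + d))

end

noncomputable section

/-! The lower bound is Le Cam's two-point method along the pair `f`, `-f` with `f x = L h^β g((x -
x₀)/h)`, a rescaled bump. If the two laws of one observation have Hellinger affinity `A`, the larger
of the two risks from `n` observations is at least `f(x₀)² A^(2n)` (`two_point_risk_pi`).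
Conditionally on `x` the laws are translates of one error density by `±f(x)`, so their squared
Hellinger distance is at most `f(x)² i_P(x)` (`lintegral_sqrt_shift_le`); hence `A ≥ 1 - δ/2` with
`δ = ∫ f² i_P dP_X` (`one_sub_le_affinity`).

Write `P = p_X(x₀) i_P(x₀)`, `B = ∫ g²` and `r = 2β/(2β+d)`. Choosing `h` so that `δ ≈ a/n` gives
`A^(2n) → exp(-a)` and the bound `g(0)² L² (a/(P L² B))^r exp(-a)` (`le_liminf_worstCaseMSE`).

For `β ≤ 1` take the extremal bump `(1 - ‖u‖^β)₊` and `a = r`, the maximiser of `a^r exp(-a)`. With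
the same `B`, the upper constant equals `(r/B)^r (1-r)^(1-r)` (`upperConst_eq`), while the lower
bound has `(r/B)^r exp(-r)`; since `log(1-r) ≤ -r`, the ratio is at most `exp(r²)`. This is largest
at `d = 1`, tends to `1` as `β → 0`, and stays below `exp(1/2) < 1.69`. For `β > 1` only positivity
is needed, and any smooth bump serves. -/

/-! ### Le Cam's two-point bound through the Hellinger affinity. -/

theorem ofReal_integral_le_lintegral_ofReal {Ω : Type*} [MeasurableSpace Ω] {μ : Measure Ω}
    {f : Ω → ℝ} (hf : Integrable f μ) :
    ENNReal.ofReal (∫ x, f x ∂μ) ≤ ∫⁻ x, ENNReal.ofReal (f x) ∂μ := by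
  refine ENNReal.ofReal_le_of_le_toReal ?_
  rw [integral_eq_lintegral_pos_part_sub_lintegral_neg_part hf]
  simp

/-- Minimising the right side over `T` gives `4 s² (ab)²/S` with `S = a² + b²`, and `(ab)²/S ≥ 2c ab
- c² S` because `(ab - cS)² ≥ 0`. Linearising in this way leaves a bound that integrates directly,
`c` being free until after integration. -/
theorem two_point_pointwise (a b T s c : ℝ) :
    4 * s ^ 2 * (2 * c * (a * b) - c ^ 2 * (a ^ 2 + b ^ 2)) ≤
      a ^ 2 * (T - s) ^ 2 + b ^ 2 * (T + s) ^ 2 := by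
  rcases (add_nonneg (sq_nonneg a) (sq_nonneg b)).eq_or_lt with h | h
  · have ha : a = 0 := by nlinarith [sq_nonneg a, sq_nonneg b]
    have hb : b = 0 := by nlinarith [sq_nonneg a, sq_nonneg b]
    simp [ha, hb]
  · refine le_of_mul_le_mul_right ?_ h
    have h1 : 0 ≤ s ^ 2 * (a * b - c * (a ^ 2 + b ^ 2)) ^ 2 := by positivity
    have h2 : 0 ≤ (a ^ 2 * (T - s) + b ^ 2 * (T + s)) ^ 2 := sq_nonneg _
    linarith [show (a ^ 2 * (T - s) ^ 2 + b ^ 2 * (T + s) ^ 2) * (a ^ 2 + b ^ 2) -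
      4 * s ^ 2 * (2 * c * (a * b) - c ^ 2 * (a ^ 2 + b ^ 2)) * (a ^ 2 + b ^ 2) =
      (a ^ 2 * (T - s) + b ^ 2 * (T + s)) ^ 2 +
        4 * (s ^ 2 * (a * b - c * (a ^ 2 + b ^ 2)) ^ 2) by ring]

/-- Le Cam's two-point bound for squared error loss in terms of the Hellinger affinity. -/
theorem two_point_risk {Ω : Type*} [MeasurableSpace Ω] {μ : Measure Ω} {a b : Ω → ℝ}
    (ha : Measurable a) (hb : Measurable b)
    (hia : Integrable (fun x => a x ^ 2) μ) (hib : Integrable (fun x => b x ^ 2) μ)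
    (h1a : ∫ x, a x ^ 2 ∂μ = 1) (h1b : ∫ x, b x ^ 2 ∂μ = 1)
    {T : Ω → ℝ} (hT : Measurable T) (s : ℝ) :
    ENNReal.ofReal (2 * s ^ 2 * (∫ x, a x * b x ∂μ) ^ 2) ≤
      ∫⁻ x, ENNReal.ofReal ((T x - s) ^ 2) ∂(μ.withDensity fun x => ENNReal.ofReal (a x ^ 2)) +
      ∫⁻ x, ENNReal.ofReal ((T x + s) ^ 2) ∂(μ.withDensity fun x => ENNReal.ofReal (b x ^ 2)) := by
  have hiab : Integrable (fun x => a x * b x) μ := by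
    refine (hia.add hib).mono' (ha.mul hb).aestronglyMeasurable (ae_of_all _ fun x => ?_)
    rw [Real.norm_eq_abs, abs_mul]
    simp only [Pi.add_apply]
    nlinarith [sq_nonneg (|a x| - |b x|), sq_abs (a x), sq_abs (b x), abs_nonneg (a x),
      abs_nonneg (b x)]
  have hiS : Integrable (fun x => a x ^ 2 + b x ^ 2) μ := hia.add hib
  set A := ∫ x, a x * b x ∂μ with hA
  -- After integration the free constant enters as `2cA - 2c²`, which is maximal at `c = A/2`.
  have hint : Integrable (fun x => 4 * s ^ 2 * (2 * (A / 2) * (a x * b x) -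
      (A / 2) ^ 2 * (a x ^ 2 + b x ^ 2))) μ :=
    ((hiab.const_mul _).sub (hiS.const_mul _)).const_mul _
  have hval : ∫ x, 4 * s ^ 2 * (2 * (A / 2) * (a x * b x) -
      (A / 2) ^ 2 * (a x ^ 2 + b x ^ 2)) ∂μ = 2 * s ^ 2 * A ^ 2 := by
    rw [integral_const_mul, integral_sub (hiab.const_mul _) (hiS.const_mul _),
      integral_const_mul, integral_const_mul, integral_add hia hib, h1a, h1b, ← hA]
    ring
  rw [lintegral_withDensity_eq_lintegral_mul _ (by fun_prop) (by fun_prop),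
    lintegral_withDensity_eq_lintegral_mul _ (by fun_prop) (by fun_prop),
    ← lintegral_add_left (by fun_prop), ← hval]
  refine (ofReal_integral_le_lintegral_ofReal hint).trans (lintegral_mono fun x => ?_)
  simp only [Pi.mul_apply]
  rw [← ENNReal.ofReal_mul (sq_nonneg _), ← ENNReal.ofReal_mul (sq_nonneg _),
    ← ENNReal.ofReal_add (by positivity) (by positivity)]
  exact ENNReal.ofReal_le_ofReal (two_point_pointwise _ _ _ _ _)

/-- A product of measures with densities has the product density. -/
theorem pi_withDensity_ofReal {ι E : Type*} [Fintype ι] [MeasurableSpace E] (μ : Measure E)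
    [IsProbabilityMeasure μ] {r : E → ℝ} (h0 : ∀ x, 0 ≤ r x)
    (hi : Integrable r μ) :
    Measure.pi (fun _ : ι => μ.withDensity fun x => ENNReal.ofReal (r x)) =
      (Measure.pi fun _ : ι => μ).withDensity fun D => ENNReal.ofReal (∏ i, r (D i)) := by
  have : IsFiniteMeasure (μ.withDensity fun x => ENNReal.ofReal (r x)) :=
    isFiniteMeasure_withDensity_ofReal hi.2
  refine Measure.pi_eq fun s hs => ?_
  have hms : MeasurableSet (Set.univ.pi s) := MeasurableSet.univ_pi hs
  rw [withDensity_apply _ hms, ← lintegral_indicator hms]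
  -- The indicator of a box is a product of indicators, so the integral over the box factorises.
  have hind : ∀ D : ι → E, (Set.univ.pi s).indicator
      (fun D => ENNReal.ofReal (∏ i, r (D i))) D =
      ENNReal.ofReal (∏ i, (s i).indicator r (D i)) := by
    intro D
    by_cases hD : D ∈ Set.univ.pi s
    · rw [Set.indicator_of_mem hD]
      congr 1
      exact Finset.prod_congr rfl fun i _ => (Set.indicator_of_mem (hD i trivial) _).symm
    · rw [Set.indicator_of_notMem hD]
      obtain ⟨i, hi⟩ : ∃ i, D i ∉ s i := by simpa [Set.mem_pi] using hD
      rw [Finset.prod_eq_zero (Finset.mem_univ i) (Set.indicator_of_notMem hi _)]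
      simp
  simp_rw [hind]
  rw [← ofReal_integral_eq_lintegral_ofReal, integral_fintype_prod_eq_prod
      (f := fun i => (s i).indicator r),
    ENNReal.ofReal_prod_of_nonneg]
  · refine Finset.prod_congr rfl fun i _ => ?_
    rw [withDensity_apply _ (hs i), integral_indicator (hs i),
      ofReal_integral_eq_lintegral_ofReal hi.integrableOn (ae_of_all _ h0)]
  · exact fun i _ => integral_nonneg fun x => Set.indicator_nonneg (fun y _ => h0 y) x
  · exact Integrable.fintype_prod (f := fun i => (s i).indicator r)
      fun i => hi.indicator (hs i)
  · exact ae_of_all _ fun D => Finset.prod_nonneg fun i _ =>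
      Set.indicator_nonneg (fun y _ => h0 y) _

/-- The two-point bound for `n` independent observations. -/
theorem two_point_risk_pi {E : Type*} [MeasurableSpace E] {μ : Measure E}
    [IsProbabilityMeasure μ] {a b : E → ℝ} (ha : Measurable a) (hb : Measurable b)
    (hia : Integrable (fun x => a x ^ 2) μ) (hib : Integrable (fun x => b x ^ 2) μ)
    (h1a : ∫ x, a x ^ 2 ∂μ = 1) (h1b : ∫ x, b x ^ 2 ∂μ = 1) (n : ℕ)
    {T : (Fin n → E) → ℝ} (hT : Measurable T) (s : ℝ) :
    ENNReal.ofReal (2 * s ^ 2 * (∫ x, a x * b x ∂μ) ^ (2 * n)) ≤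
      ∫⁻ D, ENNReal.ofReal ((T D - s) ^ 2)
        ∂(Measure.pi fun _ : Fin n => μ.withDensity fun x => ENNReal.ofReal (a x ^ 2)) +
      ∫⁻ D, ENNReal.ofReal ((T D + s) ^ 2)
        ∂(Measure.pi fun _ : Fin n => μ.withDensity fun x => ENNReal.ofReal (b x ^ 2)) := by
  have key : ∀ f : E → ℝ, ∫ D : Fin n → E, ∏ i, f (D i) ∂(Measure.pi fun _ => μ) =
      (∫ x, f x ∂μ) ^ n := fun f => by
    rw [integral_fintype_prod_eq_pow (μ := μ), Fintype.card_fin]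
  rw [pi_withDensity_ofReal μ (fun _ => sq_nonneg _) hia,
    pi_withDensity_ofReal μ (fun _ => sq_nonneg _) hib]
  have := two_point_risk (μ := Measure.pi fun _ : Fin n => μ)
    (a := fun D => ∏ i, a (D i)) (b := fun D => ∏ i, b (D i)) (by fun_prop) (by fun_prop)
    (by simp_rw [← Finset.prod_pow]; exact Integrable.fintype_prod fun _ => hia)
    (by simp_rw [← Finset.prod_pow]; exact Integrable.fintype_prod fun _ => hib)
    (by simp_rw [← Finset.prod_pow]; rw [key fun x => a x ^ 2, h1a, one_pow])
    (by simp_rw [← Finset.prod_pow]; rw [key fun x => b x ^ 2, h1b, one_pow]) hT s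
  simp_rw [← Finset.prod_mul_distrib, ← Finset.prod_pow] at this
  rwa [key fun x => a x * b x, ← pow_mul, mul_comm n] at this

/-! ### Hellinger distance between translates and Fisher information. -/

theorem sq_integral_unit_le {F : ℝ → ℝ} (hF : Continuous F) :
    (∫ s in (0 : ℝ)..1, F s) ^ 2 ≤ ∫ s in (0 : ℝ)..1, F s ^ 2 := by
  set m := ∫ s in (0 : ℝ)..1, F s with hm
  have h : 0 ≤ ∫ s in (0 : ℝ)..1, (F s - m) ^ 2 :=
    intervalIntegral.integral_nonneg zero_le_one fun _ _ => sq_nonneg _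
  have h2 : ∫ s in (0 : ℝ)..1, (F s - m) ^ 2 =
      (∫ s in (0 : ℝ)..1, F s ^ 2) - 2 * m * m + m ^ 2 := by
    have : ∀ s, (F s - m) ^ 2 = F s ^ 2 - 2 * m * F s + m ^ 2 := fun s => by ring
    simp_rw [this]
    rw [intervalIntegral.integral_add, intervalIntegral.integral_sub,
      intervalIntegral.integral_const_mul, ← hm]
    · simp
    all_goals exact Continuous.intervalIntegrable (by fun_prop) _ _
  nlinarith

/-- The squared Hellinger distance between two translates of a density is controlled by the Fisher
information. -/
theorem lintegral_sqrt_shift_le {p : ℝ → ℝ} (hpos : ∀ e, 0 < p e) (hd : Differentiable ℝ p)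
    (hs : Continuous fun e => deriv p e / p e) (t : ℝ) :
    ∫⁻ y, ENNReal.ofReal ((√(p (y - t)) - √(p (y + t))) ^ 2) ≤
      ENNReal.ofReal (t ^ 2) * ∫⁻ e, ENNReal.ofReal ((deriv p e / p e) ^ 2 * p e) := by
  -- `w` is the derivative of `√p`. The increment of `√p` over length `2t` is an average of `2t w`
  -- along the segment; Cauchy–Schwarz, Tonelli and translation invariance then give `4t² ∫ w²`,
  -- where `∫ w²` is a quarter of the Fisher information.
  set w : ℝ → ℝ := fun e => deriv p e / p e * √(p e) / 2 with hw
  have hwc : Continuous w := by have := hd.continuous; fun_prop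
  have hder : ∀ e, HasDerivAt (fun e => √(p e)) (w e) e := by
    intro e
    convert (hd e).hasDerivAt.sqrt (hpos e).ne' using 1
    have h0 : √(p e) ≠ 0 := (Real.sqrt_pos.2 (hpos e)).ne'
    have := Real.mul_self_sqrt (hpos e).le
    simp only [hw]
    rw [div_mul_eq_mul_div, div_div, div_eq_div_iff (by have := (hpos e).ne'; positivity)
      (by positivity)]
    linear_combination (2 * deriv p e) * this
  have hpt : ∀ y, ENNReal.ofReal ((√(p (y - t)) - √(p (y + t))) ^ 2) ≤
      ∫⁻ s in Set.Ioc (0 : ℝ) 1, ENNReal.ofReal ((2 * t * w (2 * t * s + (y - t))) ^ 2) := by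
    intro y
    have hF : Continuous fun s => 2 * t * w (2 * t * s + (y - t)) := by fun_prop
    have h1 : ∫ s in (0 : ℝ)..1, 2 * t * w (2 * t * s + (y - t)) =
        √(p (y + t)) - √(p (y - t)) := by
      rw [intervalIntegral.integral_eq_sub_of_hasDerivAt
        (f := fun s => √(p (2 * t * s + (y - t))))]
      · simp only [mul_one, mul_zero, zero_add]
        congr 3
        ring
      · intro s _
        have hl : HasDerivAt (fun s : ℝ => 2 * t * s + (y - t)) (2 * t) s := by
          simpa using ((hasDerivAt_id s).const_mul (2 * t)).add_const (y - t)
        have := (hder (2 * t * s + (y - t))).comp s hl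
        rwa [mul_comm (w _)] at this
      · exact hF.intervalIntegrable _ _
    rw [← ofReal_integral_eq_lintegral_ofReal, ← intervalIntegral.integral_of_le zero_le_one]
    · refine ENNReal.ofReal_le_ofReal ?_
      rw [← neg_sub, neg_sq, ← h1]
      exact sq_integral_unit_le hF
    · exact ((hF.pow 2).integrableOn_Icc (a := 0) (b := 1)).mono_set Set.Ioc_subset_Icc_self
    · exact ae_of_all _ fun _ => sq_nonneg _
  calc ∫⁻ y, ENNReal.ofReal ((√(p (y - t)) - √(p (y + t))) ^ 2)
      ≤ ∫⁻ y, ∫⁻ s in Set.Ioc (0 : ℝ) 1,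
          ENNReal.ofReal ((2 * t * w (2 * t * s + (y - t))) ^ 2) := lintegral_mono hpt
    _ = ∫⁻ s in Set.Ioc (0 : ℝ) 1, ∫⁻ y,
          ENNReal.ofReal ((2 * t * w (2 * t * s + (y - t))) ^ 2) :=
        lintegral_lintegral_swap (by
          have := hwc.measurable
          unfold Function.uncurry
          fun_prop)
    _ = ∫⁻ s in Set.Ioc (0 : ℝ) 1, ∫⁻ y, ENNReal.ofReal ((2 * t * w y) ^ 2) := by
        refine lintegral_congr fun s => ?_
        have := lintegral_add_left_eq_self (μ := volume)
          (fun y => ENNReal.ofReal ((2 * t * w y) ^ 2)) (2 * t * s - t)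
        rw [← this]
        refine lintegral_congr fun y => ?_
        ring_nf
    _ = ENNReal.ofReal (t ^ 2) * ∫⁻ e, ENNReal.ofReal ((deriv p e / p e) ^ 2 * p e) := by
        rw [setLIntegral_const]
        simp only [Real.volume_Ioc, sub_zero, ENNReal.ofReal_one, mul_one]
        rw [← lintegral_const_mul' _ _ ENNReal.ofReal_ne_top]
        refine lintegral_congr fun y => ?_
        rw [← ENNReal.ofReal_mul (sq_nonneg _)]
        congr 1
        simp only [hw]
        linear_combination (t ^ 2 * (deriv p y / p y) ^ 2) * Real.sq_sqrt (hpos y).le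

/-! ### Likelihood ratios in the regression model, relative to the law for `f = 0`. -/

open Classical in
/-- The error density, extended by `1` outside `U`. -/
def extDensity {d : ℕ} (U : Set (Fin d → ℝ)) (p : (Fin d → ℝ) → ℝ → ℝ)
    (x : Fin d → ℝ) (e : ℝ) : ℝ :=
  if x ∈ U then p x e else 1

/-- The square root of the likelihood ratio of the regression function `f` against `0`. -/
def likelihoodAmp {d : ℕ} (U : Set (Fin d → ℝ)) (p : (Fin d → ℝ) → ℝ → ℝ)
    (f : (Fin d → ℝ) → ℝ) (z : (Fin d → ℝ) × ℝ) : ℝ :=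
  √(extDensity U p z.1 (z.2 - f z.1) / extDensity U p z.1 z.2)

theorem tendsto_mean_of_continuous {g : ℝ → ℝ} (hg : Continuous g) (e : ℝ) :
    Tendsto (fun n : ℕ => ((n : ℝ) + 1) * ∫ u in e..(e + 1 / ((n : ℝ) + 1)), g u) atTop
      (𝓝 (g e)) := by
  have h := (hg.integral_hasStrictDerivAt e e).hasDerivAt
  rw [hasDerivAt_iff_tendsto_slope_zero] at h
  have h0 : Tendsto (fun n : ℕ => 1 / ((n : ℝ) + 1)) atTop (𝓝[≠] 0) := by
    refine tendsto_nhdsWithin_iff.2 ⟨tendsto_one_div_add_atTop_nhds_zero_nat, ?_⟩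
    exact Eventually.of_forall fun n => by
      simp only [Set.mem_compl_iff, Set.mem_singleton_iff]; positivity
  refine (h.comp h0).congr fun n => ?_
  simp

section

variable {d : ℕ} {q : ℝ} {X U : Set (Fin d → ℝ)} {PX : Measure (Fin d → ℝ)}
  {pX : (Fin d → ℝ) → ℝ} {κ : Kernel (Fin d → ℝ) ℝ} {p : (Fin d → ℝ) → ℝ → ℝ}

theorem extDensity_pos (M : RegularModel q X U PX pX κ p) (x : Fin d → ℝ) (e : ℝ) :
    0 < extDensity U p x e := by
  unfold extDensity
  split_ifs with hx
  · exact M.error_density_pos x hx e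
  · exact one_pos

theorem continuous_extDensity (M : RegularModel q X U PX pX κ p) (x : Fin d → ℝ) :
    Continuous (extDensity U p x) := by
  by_cases hx : x ∈ U
  · have : extDensity U p x = p x := by ext e; simp [extDensity, hx]
    rw [this]
    exact (M.error_density_diff x hx).continuous
  · have : extDensity U p x = fun _ => 1 := by ext e; simp [extDensity, hx]
    rw [this]
    exact continuous_const

/-- Joint measurability of `p` is not part of the model and is recovered from the kernel: `p x e` is
the limit of the mean density of `κ x` on shrinking intervals `(e, e + 1/(n+1)]`, hence measurable
in `x`. Continuity in `e` then gives joint measurability. -/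
theorem measurable_extDensity (M : RegularModel q X U PX pX κ p) :
    Measurable (Function.uncurry (extDensity U p)) := by
  classical
  have hU := M.isOpen.measurableSet
  have hfix : ∀ e, Measurable fun x => extDensity U p x e := by
    intro e
    refine measurable_of_tendsto_metrizable (f := fun (n : ℕ) x => if x ∈ U then
      ((n : ℝ) + 1) * (κ x (Set.Ioc e (e + 1 / ((n : ℝ) + 1)))).toReal else 1)
      (fun n => ?_) (tendsto_pi_nhds.2 fun x => ?_)
    · exact Measurable.ite hU
        (((κ.measurable_coe measurableSet_Ioc).ennreal_toReal).const_mul _) measurable_const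
    · by_cases hx : x ∈ U
      · simp only [hx, if_true, extDensity]
        have hc := (M.error_density_diff x hx).continuous
        refine (tendsto_mean_of_continuous hc e).congr fun n => ?_
        have hle : e ≤ e + 1 / ((n : ℝ) + 1) := by
          have : (0 : ℝ) < 1 / ((n : ℝ) + 1) := by positivity
          linarith
        rw [M.error_density x hx, withDensity_apply _ measurableSet_Ioc,
          ← ofReal_integral_eq_lintegral_ofReal, ENNReal.toReal_ofReal,
          intervalIntegral.integral_of_le hle]
        · exact integral_nonneg fun u => (M.error_density_pos x hx u).le
        · exact (hc.integrableOn_Icc).mono_set Set.Ioc_subset_Icc_self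
        · exact ae_of_all _ fun u => (M.error_density_pos x hx u).le
      · simp [hx, extDensity]
  have := measurable_uncurry_of_continuous_of_measurable
    (u := fun (e : ℝ) x => extDensity U p x e) (fun x => continuous_extDensity M x) hfix
  exact this.comp measurable_swap

theorem measurable_likelihoodAmp (M : RegularModel q X U PX pX κ p) {f : (Fin d → ℝ) → ℝ}
    (hf : Measurable f) : Measurable (likelihoodAmp U p f) := by
  have h := measurable_extDensity M
  unfold likelihoodAmp
  refine Measurable.sqrt (Measurable.div ?_ ?_)
  · exact h.comp (measurable_fst.prodMk (measurable_snd.sub (hf.comp measurable_fst)))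
  · exact h.comp (measurable_fst.prodMk measurable_snd)

theorem likelihoodAmp_sq (M : RegularModel q X U PX pX κ p) (f : (Fin d → ℝ) → ℝ)
    (z : (Fin d → ℝ) × ℝ) : likelihoodAmp U p f z ^ 2 =
      extDensity U p z.1 (z.2 - f z.1) / extDensity U p z.1 z.2 :=
  Real.sq_sqrt (div_pos (extDensity_pos M _ _) (extDensity_pos M _ _)).le

theorem lintegral_error_eq (M : RegularModel q X U PX pX κ p) {x : Fin d → ℝ} (hx : x ∈ U)
    {g : ℝ → ℝ≥0∞} (hg : Measurable g) :
    ∫⁻ e, g e ∂(κ x) = ∫⁻ e, ENNReal.ofReal (p x e) * g e := by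
  have hc := (M.error_density_diff x hx).continuous.measurable
  rw [M.error_density x hx, lintegral_withDensity_eq_lintegral_mul _ (by fun_prop) hg]
  rfl

/-- For `x ∈ U`, translate the error integral by `f x`. Off `U` no density is available, but there
`f` vanishes and the extended ratio is `1/1`. -/
theorem regressionLaw_eq_withDensity (M : RegularModel q X U PX pX κ p) {f : (Fin d → ℝ) → ℝ}
    (hf : Measurable f) (hfU : ∀ x ∉ U, f x = 0) :
    regressionLaw PX κ f =
      (PX ⊗ₘ κ).withDensity fun z => ENNReal.ofReal (likelihoodAmp U p f z ^ 2) := by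
  have := M.isProb
  have := M.isMarkov
  have hamp := measurable_likelihoodAmp M hf
  refine Measure.ext_of_lintegral _ fun h hh => ?_
  have hm : Measurable fun z : (Fin d → ℝ) × ℝ => (z.1, f z.1 + z.2) := by fun_prop
  rw [regressionLaw, lintegral_map hh hm,
    lintegral_withDensity_eq_lintegral_mul _ (by fun_prop) hh,
    Measure.lintegral_compProd (by fun_prop), Measure.lintegral_compProd (by fun_prop)]
  refine lintegral_congr fun x => ?_
  simp only [Pi.mul_apply, likelihoodAmp_sq M]
  by_cases hx : x ∈ U
  · have hc := (M.error_density_diff x hx).continuous.measurable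
    simp only [extDensity, hx, if_true]
    rw [lintegral_error_eq M hx (by fun_prop), lintegral_error_eq M hx (by fun_prop),
      ← lintegral_add_left_eq_self (μ := volume) (fun y => ENNReal.ofReal (p x y) *
        (ENNReal.ofReal (p x (y - f x) / p x y) * h (x, y))) (f x)]
    refine (lintegral_congr fun y => ?_)
    rw [← mul_assoc, ← ENNReal.ofReal_mul (M.error_density_pos x hx _).le,
      mul_div_cancel₀ _ (M.error_density_pos x hx _).ne', add_sub_cancel_left]
  · simp [extDensity, hx, hfU x hx]

theorem lintegral_likelihoodAmp_sq (M : RegularModel q X U PX pX κ p) {f : (Fin d → ℝ) → ℝ}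
    (hf : Measurable f) (hfU : ∀ x ∉ U, f x = 0) :
    ∫⁻ z, ENNReal.ofReal (likelihoodAmp U p f z ^ 2) ∂(PX ⊗ₘ κ) = 1 := by
  have := M.isProb
  have := M.isMarkov
  have h1 : regressionLaw PX κ f Set.univ = 1 := by
    rw [regressionLaw, Measure.map_apply (by fun_prop) MeasurableSet.univ]
    simp
  rwa [regressionLaw_eq_withDensity M hf hfU, withDensity_apply _ MeasurableSet.univ,
    setLIntegral_univ] at h1

theorem integrable_likelihoodAmp_sq (M : RegularModel q X U PX pX κ p) {f : (Fin d → ℝ) → ℝ}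
    (hf : Measurable f) (hfU : ∀ x ∉ U, f x = 0) :
    Integrable (fun z => likelihoodAmp U p f z ^ 2) (PX ⊗ₘ κ) := by
  have hamp := measurable_likelihoodAmp M hf
  refine ⟨by fun_prop, ?_⟩
  rw [hasFiniteIntegral_iff_ofReal (ae_of_all _ fun _ => sq_nonneg _),
    lintegral_likelihoodAmp_sq M hf hfU]
  exact ENNReal.one_lt_top

theorem integral_likelihoodAmp_sq (M : RegularModel q X U PX pX κ p) {f : (Fin d → ℝ) → ℝ}
    (hf : Measurable f) (hfU : ∀ x ∉ U, f x = 0) :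
    ∫ z, likelihoodAmp U p f z ^ 2 ∂(PX ⊗ₘ κ) = 1 := by
  rw [integral_eq_lintegral_of_nonneg_ae (ae_of_all _ fun _ => sq_nonneg _)
    (integrable_likelihoodAmp_sq M hf hfU).1, lintegral_likelihoodAmp_sq M hf hfU]
  rfl

theorem lintegral_score_sq (M : RegularModel q X U PX pX κ p) {x : Fin d → ℝ} (hx : x ∈ U) :
    ∫⁻ e, ENNReal.ofReal ((deriv (p x) e / p x e) ^ 2 * p x e) =
      ENNReal.ofReal (condFisher κ p x) := by
  have hs : Continuous fun e => deriv (p x) e / p x e := (M.score_diff x hx).continuous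
  have h := ofReal_integral_eq_lintegral_ofReal (M.fisher_finite x hx)
    (ae_of_all _ fun _ => sq_nonneg _)
  rw [condFisher, h, lintegral_error_eq M hx]
  · refine lintegral_congr fun e => ?_
    rw [← ENNReal.ofReal_mul (M.error_density_pos x hx _).le, mul_comm]
    rfl
  · have := (M.score_diff x hx).continuous.measurable
    fun_prop

/-- For fixed `x`, the reference density `p x y` cancels the denominators of both amplitudes,
leaving the Hellinger distance between the translates of `p x` by `±f x`. -/
theorem lintegral_likelihoodAmp_sub_sq_le (M : RegularModel q X U PX pX κ p)
    {f : (Fin d → ℝ) → ℝ} (hf : Measurable f) (hfU : ∀ x ∉ U, f x = 0) :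
    ∫⁻ z, ENNReal.ofReal ((likelihoodAmp U p f z - likelihoodAmp U p (-f) z) ^ 2) ∂(PX ⊗ₘ κ) ≤
      ∫⁻ x in U, ENNReal.ofReal (f x ^ 2 * condFisher κ p x) ∂PX := by
  have := M.isProb
  have := M.isMarkov
  have h1 := measurable_likelihoodAmp M hf
  have h2 := measurable_likelihoodAmp M hf.neg
  rw [Measure.lintegral_compProd (by fun_prop), ← lintegral_indicator M.isOpen.measurableSet]
  refine lintegral_mono fun x => ?_
  by_cases hx : x ∈ U
  · have hd := M.error_density_diff x hx
    have hc := hd.continuous.measurable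
    have hp := M.error_density_pos x hx
    rw [Set.indicator_of_mem hx]
    simp only [likelihoodAmp, extDensity, hx, if_true, Pi.neg_apply, sub_neg_eq_add]
    rw [lintegral_error_eq M hx (by fun_prop), ENNReal.ofReal_mul (sq_nonneg _),
      ← lintegral_score_sq M hx]
    refine le_trans (le_of_eq (lintegral_congr fun y => ?_))
      (lintegral_sqrt_shift_le hp hd (M.score_diff x hx).continuous (f x))
    rw [← ENNReal.ofReal_mul (hp y).le]
    congr 1
    rw [Real.sqrt_div (hp _).le, Real.sqrt_div (hp _).le, ← sub_div, div_pow,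
      Real.sq_sqrt (hp y).le, mul_div_cancel₀ _ (hp y).ne']
  · simp [likelihoodAmp, hx, hfU x hx]

theorem one_sub_le_affinity (M : RegularModel q X U PX pX κ p) {f : (Fin d → ℝ) → ℝ}
    (hf : Measurable f) (hfU : ∀ x ∉ U, f x = 0) {δ : ℝ} (hδ : 0 ≤ δ)
    (hle : ∫⁻ x in U, ENNReal.ofReal (f x ^ 2 * condFisher κ p x) ∂PX ≤ ENNReal.ofReal δ) :
    1 - δ / 2 ≤ ∫ z, likelihoodAmp U p f z * likelihoodAmp U p (-f) z ∂(PX ⊗ₘ κ) := by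
  have hfU' : ∀ x ∉ U, (-f) x = 0 := fun x hx => by simp [hfU x hx]
  have h1 := measurable_likelihoodAmp M hf
  have h2 := measurable_likelihoodAmp M hf.neg
  have i1 := integrable_likelihoodAmp_sq M hf hfU
  have i2 := integrable_likelihoodAmp_sq M hf.neg hfU'
  have hb := (lintegral_likelihoodAmp_sub_sq_le M hf hfU).trans hle
  set a := likelihoodAmp U p f
  set b := likelihoodAmp U p (-f)
  have i3 : Integrable (fun z => (a z - b z) ^ 2) (PX ⊗ₘ κ) := by
    refine ⟨by fun_prop, ?_⟩
    rw [hasFiniteIntegral_iff_ofReal (ae_of_all _ fun _ => sq_nonneg _)]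
    exact hb.trans_lt ENNReal.ofReal_lt_top
  have h3 : ∫ z, (a z - b z) ^ 2 ∂(PX ⊗ₘ κ) ≤ δ := by
    rw [integral_eq_lintegral_of_nonneg_ae (ae_of_all _ fun _ => sq_nonneg _) i3.1]
    exact ENNReal.toReal_le_of_le_ofReal hδ hb
  -- Both squares integrate to `1`, so the affinity is one minus half the squared Hellinger
  -- distance.
  have h4 : ∀ z, a z * b z = (a z ^ 2 + b z ^ 2 - (a z - b z) ^ 2) / 2 := fun z => by ring
  simp_rw [h4]
  have i12 : Integrable (fun z => a z ^ 2 + b z ^ 2) (PX ⊗ₘ κ) := i1.add i2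
  rw [integral_div, integral_sub i12 i3, integral_add i1 i2,
    integral_likelihoodAmp_sq M hf hfU, integral_likelihoodAmp_sq M hf.neg hfU']
  linarith

/-- The worst-case risk over a pair of opposite regression functions. -/
theorem le_worstCaseMSE (M : RegularModel q X U PX pX κ p) {β L : ℝ} {f : (Fin d → ℝ) → ℝ}
    (hf : Measurable f) (hfU : ∀ x ∉ U, f x = 0) (hH : f ∈ HolderClass q β L U)
    (hH' : -f ∈ HolderClass q β L U) {δ : ℝ} (hδ : 0 ≤ δ) (hδ2 : δ ≤ 2)
    (hle : ∫⁻ x in U, ENNReal.ofReal (f x ^ 2 * condFisher κ p x) ∂PX ≤ ENNReal.ofReal δ)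
    (x₀ : Fin d → ℝ) (n : ℕ) (fhat : RegressionEstimator d n)
    (hfhat : Measurable fun D => fhat D x₀) :
    ENNReal.ofReal ((n : ℝ) ^ (2 * β / (2 * β + d)) * (f x₀ ^ 2 * (1 - δ / 2) ^ (2 * n))) ≤
      worstCaseMSE q β L U PX κ x₀ n fhat := by
  have := M.isProb
  have := M.isMarkov
  have hfU' : ∀ x ∉ U, (-f) x = 0 := fun x hx => by simp [hfU x hx]
  have haff := one_sub_le_affinity M hf hfU hδ hle
  have hrisk := two_point_risk_pi (measurable_likelihoodAmp M hf)
    (measurable_likelihoodAmp M hf.neg) (integrable_likelihoodAmp_sq M hf hfU)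
    (integrable_likelihoodAmp_sq M hf.neg hfU') (integral_likelihoodAmp_sq M hf hfU)
    (integral_likelihoodAmp_sq M hf.neg hfU') n hfhat (f x₀)
  rw [← regressionLaw_eq_withDensity M hf hfU, ← regressionLaw_eq_withDensity M hf.neg hfU']
    at hrisk
  set N : ℝ := (n : ℝ) ^ (2 * β / (2 * β + d)) with hN
  have hN0 : 0 ≤ N := by positivity
  have hW : ∀ g : (Fin d → ℝ) → ℝ, Measurable g → g ∈ HolderClass q β L U →
      ENNReal.ofReal N * ∫⁻ D, ENNReal.ofReal ((fhat D x₀ - g x₀) ^ 2)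
        ∂(Measure.pi fun _ : Fin n => regressionLaw PX κ g) ≤
      worstCaseMSE q β L U PX κ x₀ n fhat := by
    intro g hg hgH
    rw [← lintegral_const_mul' _ _ ENNReal.ofReal_ne_top]
    simp_rw [← ENNReal.ofReal_mul hN0]
    exact le_iSup₂ (f := fun g (_ : g ∈ {f : (Fin d → ℝ) → ℝ | Measurable f ∧
      f ∈ HolderClass q β L U}) => ∫⁻ D, ENNReal.ofReal (N * (fhat D x₀ - g x₀) ^ 2)
        ∂(Measure.pi fun _ : Fin n => regressionLaw PX κ g)) g ⟨hg, hgH⟩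
  have hW1 := hW f hf hH
  have hW2 := hW (-f) hf.neg hH'
  simp only [Pi.neg_apply, sub_neg_eq_add] at hW2
  set W := worstCaseMSE q β L U PX κ x₀ n fhat
  -- Each of the two risks is at most `W`, so their sum is at most `2 W`. The bound `δ ≤ 2` keeps `1
  -- - δ/2` nonnegative, so powers preserve the affinity inequality.
  have h2 : ENNReal.ofReal 2 * ENNReal.ofReal (N * (f x₀ ^ 2 * (1 - δ / 2) ^ (2 * n))) ≤
      ENNReal.ofReal 2 * W := by
    calc _ = ENNReal.ofReal N * ENNReal.ofReal (2 * f x₀ ^ 2 * (1 - δ / 2) ^ (2 * n)) := by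
          rw [← ENNReal.ofReal_mul (by norm_num), ← ENNReal.ofReal_mul hN0]
          congr 1
          ring
      _ ≤ ENNReal.ofReal N * ENNReal.ofReal (2 * f x₀ ^ 2 *
            (∫ z, likelihoodAmp U p f z * likelihoodAmp U p (-f) z ∂(PX ⊗ₘ κ)) ^ (2 * n)) := by
          gcongr
          linarith
      _ ≤ W + W := by
          refine (mul_le_mul_right hrisk _).trans ?_
          rw [mul_add]
          exact add_le_add hW1 hW2
      _ = _ := by rw [← two_mul]; norm_num
  exact (ENNReal.mul_le_mul_iff_right (by norm_num) ENNReal.ofReal_ne_top).1 h2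

end

/-! ### Rescaled bumps and the asymptotic lower bound. -/

theorem neg_mem_holderClass {d : ℕ} {q β L : ℝ} {U : Set (Fin d → ℝ)} {f : (Fin d → ℝ) → ℝ}
    (hf : f ∈ HolderClass q β L U) : -f ∈ HolderClass q β L U := by
  have h : ∀ (k : ℕ) (j : Fin k → Fin d) x, mixedPartial j (-f) x = -mixedPartial j f x := by
    intro k j x
    simp only [mixedPartial, iteratedFDeriv_neg_apply, neg_apply]
  obtain ⟨h1, h2, h3⟩ := hf
  refine ⟨h1.neg, fun k hk j x hx => ?_, fun j x hx y hy => ?_⟩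
  · rw [h, abs_neg]
    exact h2 k hk j x hx
  · rw [h, h, neg_sub_neg, abs_sub_comm]
    exact h3 j x hx y hy

/-- Rescaled copies of `g` belong to every Hölder class `𝓗(β, L)`. -/
structure IsHolderBump (q β : ℝ) {d : ℕ} (g : (Fin d → ℝ) → ℝ) (B : ℝ) : Prop where
  measurable : Measurable g
  support : ∀ u, 1 < ‖u‖ → g u = 0
  pos : 0 < B
  lintegral_sq : ∫⁻ u, ENNReal.ofReal (g u ^ 2) = ENNReal.ofReal B
  mem_holder : ∀ (L : ℝ), 0 < L → ∀ (U : Set (Fin d → ℝ)) (x₀ : Fin d → ℝ) (h : ℝ), 0 < h →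
    h ≤ 1 → (fun x => L * h ^ β * g (h⁻¹ • (x - x₀))) ∈ HolderClass q β L U

theorem lintegral_comp_inv_smul_sub {d : ℕ} {G : (Fin d → ℝ) → ℝ≥0∞} (hG : Measurable G)
    (x₀ : Fin d → ℝ) {h : ℝ} (hh : 0 < h) :
    ∫⁻ x, G (h⁻¹ • (x - x₀)) = ENNReal.ofReal (h ^ d) * ∫⁻ u, G u := by
  rw [lintegral_sub_right_eq_self (μ := volume) (fun x => G (h⁻¹ • x)) x₀,
    ← lintegral_map hG (by fun_prop),
    Measure.map_addHaar_smul volume (inv_ne_zero hh.ne'), lintegral_smul_measure]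
  simp [abs_of_pos hh]

section

variable {d : ℕ} {q : ℝ} {X U : Set (Fin d → ℝ)} {PX : Measure (Fin d → ℝ)}
  {pX : (Fin d → ℝ) → ℝ} {κ : Kernel (Fin d → ℝ) ℝ} {p : (Fin d → ℝ) → ℝ → ℝ}

theorem continuousOn_covariate_density (M : RegularModel q X U PX pX κ p) :
    ContinuousOn pX U := by
  obtain ⟨_, _, _, _, h⟩ := M.covariate_holder
  exact h.1.continuousOn

/-- The bound `P` is needed only where `f ≠ 0`: for a bump shrinking to `x₀` it can be taken
arbitrarily close to `pX x₀ * condFisher κ p x₀`. -/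
theorem lintegral_fisher_le (M : RegularModel q X U PX pX κ p) {f : (Fin d → ℝ) → ℝ}
    (hf : Measurable f) {P : ℝ} (hP : 0 ≤ P)
    (hle : ∀ x ∈ U, f x ≠ 0 → pX x * condFisher κ p x ≤ P) :
    ∫⁻ x in U, ENNReal.ofReal (f x ^ 2 * condFisher κ p x) ∂PX ≤
      ENNReal.ofReal P * ∫⁻ x, ENNReal.ofReal (f x ^ 2) := by
  have hU := M.isOpen.measurableSet
  have m1 : AEMeasurable pX (volume.restrict U) :=
    (continuousOn_covariate_density M).aemeasurable hU
  have m2 : AEMeasurable (condFisher κ p) (volume.restrict U) :=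
    M.fisher_uniform.continuousOn.aemeasurable hU
  have m3 : AEMeasurable (fun x => ENNReal.ofReal (f x ^ 2 * condFisher κ p x))
      (volume.restrict U) := ((hf.pow_const 2).aemeasurable.mul m2).ennreal_ofReal
  rw [M.covariate_density, lintegral_withDensity_eq_lintegral_mul₀ m1.ennreal_ofReal m3,
    ← lintegral_const_mul' _ _ ENNReal.ofReal_ne_top]
  refine le_trans (lintegral_mono_ae ?_) (setLIntegral_le_lintegral U _)
  filter_upwards [ae_restrict_mem hU] with x hx
  obtain ⟨cX, _, hc, hb⟩ := M.covariate_bounds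
  simp only [Pi.mul_apply]
  rw [← ENNReal.ofReal_mul (hc.le.trans (hb x hx).1), ← ENNReal.ofReal_mul hP]
  refine ENNReal.ofReal_le_ofReal ?_
  by_cases h0 : f x = 0
  · simp [h0]
  · nlinarith [hle x hx h0, sq_nonneg (f x)]

theorem tendsto_one_sub_div_pow_two_mul (a : ℝ) :
    Tendsto (fun n : ℕ => (1 - a / n / 2) ^ (2 * n)) atTop (𝓝 (Real.exp (-a))) := by
  have h : Tendsto (fun n : ℕ => (1 + -(a / n / 2)) ^ n) atTop (𝓝 (Real.exp (-a / 2))) := by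
    refine Real.tendsto_one_add_pow_exp_of_tendsto ?_
    refine tendsto_const_nhds.congr' ?_
    filter_upwards [eventually_gt_atTop 0] with n hn
    have : (n : ℝ) ≠ 0 := by positivity
    field_simp
  have h2 := h.pow 2
  rw [← Real.exp_nat_mul] at h2
  convert h2 using 2
  · rw [← pow_mul, mul_comm 2, sub_eq_add_neg]
  · push_cast; ring_nf

/-- The asymptotic minimax lower bound obtained by perturbing the zero function by rescaled copies
of a bump function. -/
theorem le_liminf_worstCaseMSE (M : RegularModel q X U PX pX κ p) {β L : ℝ} (hβ : 0 < β)
    (hL : 0 < L) {x₀ : Fin d → ℝ} (hx₀ : x₀ ∈ U) (hi : 0 < condFisher κ p x₀)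
    {g : (Fin d → ℝ) → ℝ} {B : ℝ} (hg : IsHolderBump q β g B) {a : ℝ} (ha : 0 < a)
    (fhat : (n : ℕ) → RegressionEstimator d n) (hfhat : ∀ n, Measurable fun D => fhat n D x₀) :
    ENNReal.ofReal (g 0 ^ 2 * L ^ 2 *
        (a / (pX x₀ * condFisher κ p x₀ * L ^ 2 * B)) ^ (2 * β / (2 * β + d)) * Real.exp (-a)) ≤
      liminf (fun n => worstCaseMSE q β L U PX κ x₀ n (fhat n)) atTop := by
  obtain ⟨cX, _, hc, hb⟩ := M.covariate_bounds
  have hB := hg.pos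
  set P := pX x₀ * condFisher κ p x₀ with hPdef
  have hP : 0 < P := mul_pos (hc.trans_le (hb x₀ hx₀).1) hi
  set r := 2 * β / (2 * β + d) with hr
  have hden : 0 < 2 * β + d := by positivity
  set K := g 0 ^ 2 * L ^ 2 * (a / (P * L ^ 2 * B)) ^ r with hK
  have hK0 : 0 ≤ K := by positivity
  -- The slack factor `a'/a > 1` absorbs the variation of `p_X i_P` near `x₀`; letting `a'` decrease
  -- to `a` removes it.
  have key : ∀ a' > a, ENNReal.ofReal (K * Real.exp (-a')) ≤
      liminf (fun n => worstCaseMSE q β L U PX κ x₀ n (fhat n)) atTop := by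
    intro a' haa'
    have ha' : 0 < a' := ha.trans haa'
    have hlim : Tendsto (fun n : ℕ => ENNReal.ofReal (K * (1 - a' / n / 2) ^ (2 * n))) atTop
        (𝓝 (ENNReal.ofReal (K * Real.exp (-a')))) :=
      ENNReal.tendsto_ofReal ((tendsto_one_sub_div_pow_two_mul a').const_mul K)
    rw [← hlim.liminf_eq]
    refine liminf_le_liminf ?_
    have hcont : ContinuousAt (fun x => pX x * condFisher κ p x) x₀ :=
      ((continuousOn_covariate_density M).mul M.fisher_uniform.continuousOn).continuousAt
        (M.isOpen.mem_nhds hx₀)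
    have hlt : P < a' / a * P := by
      rw [lt_mul_iff_one_lt_left hP, one_lt_div ha]; exact haa'
    obtain ⟨ρ, hρ, hball⟩ := Metric.mem_nhds_iff.1
      (Filter.inter_mem (M.isOpen.mem_nhds hx₀) (hcont.eventually_lt continuousAt_const hlt))
    -- The bandwidth solves `n P ∫ f² = a`, since `∫ f² = L² h^(2β+d) B`.
    set h : ℕ → ℝ := fun n => (a / (P * L ^ 2 * B) / n) ^ (1 / (2 * β + d)) with hh
    have hh0 : Tendsto h atTop (𝓝 0) := by
      have h1 : Tendsto (fun n : ℕ => a / (P * L ^ 2 * B) / (n : ℝ)) atTop (𝓝 0) :=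
        tendsto_const_div_atTop_nhds_zero_nat _
      have h2 := h1.rpow_const (p := 1 / (2 * β + d)) (Or.inr (by positivity))
      rwa [Real.zero_rpow (by positivity)] at h2
    -- Eventually `h < 1` (Hölder membership), `h < ρ` (support inside the good ball) and `a'/n < 2`
    -- (nonnegative affinity bound).
    filter_upwards [eventually_gt_atTop 0, hh0.eventually_lt_const one_pos,
      hh0.eventually_lt_const hρ,
      (tendsto_const_div_atTop_nhds_zero_nat a').eventually_lt_const (u := 2) (by norm_num)]
      with n hn hn1 hnρ hn2
    have hn0 : (0 : ℝ) < n := by exact_mod_cast hn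
    have hhpos : 0 < h n := by positivity
    have hpow : h n ^ (2 * β + d) = a / (P * L ^ 2 * B) / n := by
      rw [hh, ← Real.rpow_mul (by positivity), one_div_mul_cancel hden.ne', Real.rpow_one]
    have hpow2 : (h n ^ β) ^ 2 = (a / (P * L ^ 2 * B)) ^ r / (n : ℝ) ^ r := by
      rw [← Real.div_rpow (by positivity) hn0.le, hh, ← Real.rpow_natCast, ← Real.rpow_mul
        (by positivity), ← Real.rpow_mul (by positivity)]
      congr 1
      rw [hr]
      push_cast
      ring
    set f : (Fin d → ℝ) → ℝ := fun x => L * h n ^ β * g ((h n)⁻¹ • (x - x₀)) with hf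
    have hfm : Measurable f := by have := hg.measurable; fun_prop
    have hsupp : ∀ x, f x ≠ 0 → x ∈ U ∧ pX x * condFisher κ p x < a' / a * P := by
      intro x hx
      refine hball ?_
      rw [Metric.mem_ball, dist_eq_norm]
      by_contra hcon
      refine hx ?_
      simp only [hf]
      rw [hg.support, mul_zero]
      rw [norm_smul, norm_inv, Real.norm_of_nonneg hhpos.le, ← div_eq_inv_mul, one_lt_div hhpos]
      linarith
    have hfH : f ∈ HolderClass q β L U := hg.mem_holder L hL U x₀ (h n) hhpos hn1.le
    have hint : ∫⁻ x in U, ENNReal.ofReal (f x ^ 2 * condFisher κ p x) ∂PX ≤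
        ENNReal.ofReal (a' / n) := by
      refine (lintegral_fisher_le M hfm (P := a' / a * P) (by positivity)
        fun x _ hx => (hsupp x hx).2.le).trans (le_of_eq ?_)
      have hgm := hg.measurable
      have : ∀ x, ENNReal.ofReal (f x ^ 2) = ENNReal.ofReal ((L * h n ^ β) ^ 2) *
          ENNReal.ofReal (g ((h n)⁻¹ • (x - x₀)) ^ 2) := fun x => by
        rw [← ENNReal.ofReal_mul (by positivity), ← mul_pow]
      simp_rw [this]
      rw [lintegral_const_mul' _ _ ENNReal.ofReal_ne_top,
        lintegral_comp_inv_smul_sub (G := fun u => ENNReal.ofReal (g u ^ 2)) (by fun_prop) x₀ hhpos,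
        hg.lintegral_sq, ← ENNReal.ofReal_mul (by positivity), ← ENNReal.ofReal_mul (by positivity),
        ← ENNReal.ofReal_mul (by positivity)]
      congr 1
      have : (h n ^ β) ^ 2 * h n ^ d = a / (P * L ^ 2 * B) / n := by
        rw [← hpow, Real.rpow_add hhpos, Real.rpow_natCast, two_mul, Real.rpow_add hhpos, sq]
      calc a' / a * P * ((L * h n ^ β) ^ 2 * (h n ^ d * B))
          = a' / a * P * L ^ 2 * B * ((h n ^ β) ^ 2 * h n ^ d) := by ring
        _ = a' / n := by rw [this]; field_simp
    refine le_trans (le_of_eq ?_) (le_worstCaseMSE M hfm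
      (fun x hx => by_contra fun h0 => hx (hsupp x h0).1) hfH (neg_mem_holderClass hfH)
      (δ := a' / n) (by positivity) hn2.le hint x₀ n (fhat n) (hfhat n))
    congr 1
    rw [← mul_assoc]
    congr 1
    simp only [hf, sub_self, smul_zero]
    rw [mul_pow, mul_pow, hpow2, hK, ← hr]
    have : (n : ℝ) ^ r ≠ 0 := by positivity
    field_simp
  have hlim : Tendsto (fun a' => ENNReal.ofReal (K * Real.exp (-a'))) (𝓝[>] a)
      (𝓝 (ENNReal.ofReal (K * Real.exp (-a)))) := by
    refine Tendsto.mono_left (ENNReal.tendsto_ofReal ?_) nhdsWithin_le_nhds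
    exact Continuous.tendsto (by fun_prop) a
  exact le_of_tendsto hlim (by filter_upwards [self_mem_nhdsWithin] with a' h using key a' h)

end

/-! ### The `ℓ_q` norm and the extremal bump for `β ≤ 1`. -/

section

variable {d : ℕ} {q : ℝ}

theorem lqNorm_nonneg (q : ℝ) (x : Fin d → ℝ) : 0 ≤ lqNorm q x :=
  Real.rpow_nonneg (Finset.sum_nonneg fun _ _ => Real.rpow_nonneg (abs_nonneg _) _) _

theorem continuous_lqNorm (hq : 1 ≤ q) : Continuous (lqNorm q : (Fin d → ℝ) → ℝ) := by
  unfold lqNorm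
  refine Continuous.rpow_const (continuous_finsetSum _ fun i _ => ?_)
    fun _ => Or.inr (by positivity)
  exact Continuous.rpow_const (by fun_prop) fun _ => Or.inr (by positivity)

theorem lqNorm_add_le (hq : 1 ≤ q) (x y : Fin d → ℝ) :
    lqNorm q (x + y) ≤ lqNorm q x + lqNorm q y :=
  Real.Lp_add_le Finset.univ x y hq

theorem lqNorm_smul (hq : 1 ≤ q) (c : ℝ) (x : Fin d → ℝ) :
    lqNorm q (c • x) = |c| * lqNorm q x := by
  have hq0 : 0 < q := by linarith
  simp only [lqNorm, Pi.smul_apply, smul_eq_mul, abs_mul]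
  simp_rw [Real.mul_rpow (abs_nonneg c) (abs_nonneg _)]
  rw [← Finset.mul_sum, Real.mul_rpow (by positivity)
    (Finset.sum_nonneg fun _ _ => Real.rpow_nonneg (abs_nonneg _) _), ← Real.rpow_mul (abs_nonneg c),
    mul_one_div_cancel hq0.ne', Real.rpow_one]

theorem lqNorm_neg (q : ℝ) (x : Fin d → ℝ) : lqNorm q (-x) = lqNorm q x := by
  simp [lqNorm]

theorem lqNorm_zero (hq : 1 ≤ q) : lqNorm q (0 : Fin d → ℝ) = 0 := by
  simpa using lqNorm_smul hq 0 (0 : Fin d → ℝ)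

/-- Here `‖x‖` is the sup norm. The `ℓ_q` unit ball, outside which `powerCap` vanishes, thus lies in
the sup-norm ball demanded by `IsHolderBump`. -/
theorem norm_le_lqNorm (hq : 1 ≤ q) (x : Fin d → ℝ) : ‖x‖ ≤ lqNorm q x := by
  have hq0 : 0 < q := by linarith
  refine (pi_norm_le_iff_of_nonneg (lqNorm_nonneg q x)).2 fun i => ?_
  rw [Real.norm_eq_abs, ← Real.rpow_le_rpow_iff (abs_nonneg _) (lqNorm_nonneg q x) hq0,
    lqNorm, ← Real.rpow_mul (Finset.sum_nonneg fun _ _ => Real.rpow_nonneg (abs_nonneg _) _),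
    one_div_mul_cancel hq0.ne', Real.rpow_one]
  exact Finset.single_le_sum (f := fun i => |x i| ^ q)
    (fun _ _ => Real.rpow_nonneg (abs_nonneg _) _) (Finset.mem_univ i)

theorem lqNorm_rpow_le_add (hq : 1 ≤ q) {β : ℝ} (hβ : 0 < β) (hβ1 : β ≤ 1) (x y : Fin d → ℝ) :
    lqNorm q x ^ β ≤ lqNorm q y ^ β + lqNorm q (x - y) ^ β := by
  have h := lqNorm_add_le hq y (x - y)
  rw [add_sub_cancel] at h
  exact (Real.rpow_le_rpow (lqNorm_nonneg _ _) h hβ.le).trans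
    (Real.rpow_add_le_add_rpow (lqNorm_nonneg _ _) (lqNorm_nonneg _ _) hβ.le hβ1)

/-- The extremal function `(1 - ‖u‖^β)₊` of the Hölder class with `β ≤ 1`. -/
def powerCap (q β : ℝ) (u : Fin d → ℝ) : ℝ :=
  max 0 (1 - lqNorm q u ^ β)

theorem powerCap_nonneg (q β : ℝ) (u : Fin d → ℝ) : 0 ≤ powerCap q β u := le_max_left _ _

theorem powerCap_le_one (q β : ℝ) (u : Fin d → ℝ) : powerCap q β u ≤ 1 :=
  max_le zero_le_one (sub_le_self _ (Real.rpow_nonneg (lqNorm_nonneg _ _) _))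

theorem powerCap_zero (hq : 1 ≤ q) {β : ℝ} (hβ : 0 < β) :
    powerCap q β (0 : Fin d → ℝ) = 1 := by
  simp [powerCap, lqNorm_zero hq, Real.zero_rpow hβ.ne']

theorem continuous_powerCap (hq : 1 ≤ q) {β : ℝ} (hβ : 0 < β) :
    Continuous (powerCap q β : (Fin d → ℝ) → ℝ) := by
  unfold powerCap
  exact continuous_const.max (continuous_const.sub
    ((continuous_lqNorm hq).rpow_const fun _ => Or.inr hβ.le))

/-- For `β ≤ 1`, subadditivity of `t ↦ t^β` and the triangle inequality make `‖u‖^β` Hölder with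
constant exactly `1`; truncation at `0` is a contraction. -/
theorem abs_powerCap_sub_le (hq : 1 ≤ q) {β : ℝ} (hβ : 0 < β) (hβ1 : β ≤ 1)
    (u v : Fin d → ℝ) : |powerCap q β u - powerCap q β v| ≤ lqNorm q (u - v) ^ β := by
  refine (abs_max_sub_max_le_max 0 _ 0 _).trans (max_le ?_ ?_)
  · simpa using Real.rpow_nonneg (lqNorm_nonneg _ _) _
  · have h1 := lqNorm_rpow_le_add hq hβ hβ1 u v
    have h2 := lqNorm_rpow_le_add hq hβ hβ1 v u
    rw [← lqNorm_neg q (v - u), neg_sub] at h2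
    rw [abs_le]
    constructor <;> linarith

theorem holderOrder_eq_zero {β : ℝ} (hβ1 : β ≤ 1) : holderOrder β = 0 := by
  have : ⌈β⌉₊ ≤ 1 := Nat.ceil_le.2 (by simpa using hβ1)
  unfold holderOrder
  omega

theorem powerCap_mem_holderClass (hq : 1 ≤ q) {β : ℝ} (hβ : 0 < β) (hβ1 : β ≤ 1) {L : ℝ}
    (hL : 0 < L) (U : Set (Fin d → ℝ)) (x₀ : Fin d → ℝ) {h : ℝ} (hh : 0 < h) (hh1 : h ≤ 1) :
    (fun x => L * h ^ β * powerCap q β (h⁻¹ • (x - x₀))) ∈ HolderClass q β L U := by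
  have hc := continuous_powerCap (d := d) hq hβ
  simp only [HolderClass, Set.mem_ofPred_eq]
  rw [holderOrder_eq_zero hβ1]
  refine ⟨?_, fun k hk j x _ => ?_, fun j x _ y _ => ?_⟩
  · exact contDiffOn_zero.2 (by fun_prop)
  · obtain rfl : k = 0 := by omega
    simp only [mixedPartial, iteratedFDeriv_zero_apply]
    have h0 := powerCap_nonneg q β (h⁻¹ • (x - x₀))
    rw [abs_of_nonneg (by positivity), mul_assoc]
    refine mul_le_of_le_one_right hL.le (mul_le_one₀ (Real.rpow_le_one hh.le hh1 hβ.le) h0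
      (powerCap_le_one _ _ _))
  · simp only [mixedPartial, iteratedFDeriv_zero_apply]
    rw [← mul_sub, abs_mul, abs_of_nonneg (by positivity), mul_assoc]
    refine mul_le_mul_of_nonneg_left ?_ hL.le
    have h1 := abs_powerCap_sub_le hq hβ hβ1 (h⁻¹ • (x - x₀)) (h⁻¹ • (y - x₀))
    rw [← smul_sub, sub_sub_sub_cancel_right, lqNorm_smul hq, abs_of_pos (inv_pos.2 hh)] at h1
    calc h ^ β * |powerCap q β (h⁻¹ • (x - x₀)) - powerCap q β (h⁻¹ • (y - x₀))|
        ≤ h ^ β * (h⁻¹ * lqNorm q (x - y)) ^ β := by gcongr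
      _ = lqNorm q (x - y) ^ (β - ((0 : ℕ) : ℝ)) := by
        rw [← Real.mul_rpow hh.le (mul_nonneg (inv_pos.2 hh).le (lqNorm_nonneg _ _)),
          mul_inv_cancel_left₀ hh.ne']
        simp

/-- The volume of the unit ball of the `ℓ_q` norm. -/
def lqBallVolume (q : ℝ) (d : ℕ) : ℝ :=
  (2 * Real.Gamma (1 / q + 1)) ^ d / Real.Gamma (d / q + 1)

theorem lqBallVolume_pos (hq : 1 ≤ q) (d : ℕ) : 0 < lqBallVolume q d :=
  div_pos (pow_pos (mul_pos two_pos (Real.Gamma_pos_of_pos (by positivity))) _)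
    (Real.Gamma_pos_of_pos (by positivity))

theorem integral_mul_one_sub_rpow {s : ℝ} (hs : 0 < s) :
    ∫ t in (0 : ℝ)..1, t * (1 - t) ^ s = 1 / ((s + 1) * (s + 2)) := by
  have h := intervalIntegral.integral_comp_sub_left (a := 0) (b := 1)
    (fun t : ℝ => (1 - t) * t ^ s) 1
  norm_num only [sub_sub_cancel, sub_self, sub_zero] at h
  rw [h]
  have h2 : ∫ t in (0 : ℝ)..1, (1 - t) * t ^ s = ∫ t in (0 : ℝ)..1, (t ^ s - t ^ (s + 1)) := by
    refine intervalIntegral.integral_congr fun t ht => ?_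
    rw [Set.uIcc_of_le zero_le_one] at ht
    rw [Real.rpow_add_one' ht.1 (by positivity)]
    ring
  rw [h2, intervalIntegral.integral_sub, integral_rpow (Or.inl (by linarith)),
    integral_rpow (Or.inl (by linarith)), Real.one_rpow, Real.one_rpow,
    Real.zero_rpow (by positivity), Real.zero_rpow (by positivity)]
  · field_simp
    ring
  · exact (Continuous.rpow_const continuous_id fun _ => Or.inr hs.le).intervalIntegrable _ _
  · exact (Continuous.rpow_const continuous_id
      fun _ => Or.inr (by positivity)).intervalIntegrable _ _

/-- For `0 < t < 1` the superlevel set is the open `ℓ_q` ball of radius `(1 - t)^(1/β)`. This feeds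
the layer-cake formula for `∫ powerCap²`, which reduces to the Beta integral of `t (1 - t)^(d/β)`.
-/
theorem volume_lt_powerCap (hq : 1 ≤ q) {β : ℝ} (hβ : 0 < β) (hd : 1 ≤ d) {t : ℝ} (ht : 0 < t) :
    volume {u : Fin d → ℝ | t < powerCap q β u} =
      (Set.Ioo 0 1).indicator
        (fun t => ENNReal.ofReal (lqBallVolume q d * (1 - t) ^ (d / β))) t := by
  have : Nonempty (Fin d) := ⟨⟨0, hd⟩⟩
  by_cases ht1 : t < 1
  · have hset : {u : Fin d → ℝ | t < powerCap q β u} =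
        {u | (∑ i, |u i| ^ q) ^ (1 / q) < (1 - t) ^ β⁻¹} := by
      ext u
      simp only [Set.mem_ofPred_eq, powerCap, lt_max_iff, ht.not_gt, false_or]
      rw [show (∑ i, |u i| ^ q) ^ (1 / q) = lqNorm q u from rfl,
        Real.lt_rpow_inv_iff_of_pos (lqNorm_nonneg _ _) (by linarith) hβ]
      constructor <;> intro h <;> linarith
    rw [hset, volume_sum_rpow_lt _ hq, Set.indicator_of_mem (show t ∈ Set.Ioo 0 1 from ⟨ht, ht1⟩), Fintype.card_fin,
      mul_comm, ← ENNReal.ofReal_pow (Real.rpow_nonneg (by linarith) _), ← lqBallVolume,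
      ← ENNReal.ofReal_mul (lqBallVolume_pos hq d).le]
    congr 2
    rw [← Real.rpow_natCast, ← Real.rpow_mul (by linarith)]
    congr 1
    ring
  · rw [Set.indicator_of_notMem fun h => ht1 h.2]
    convert measure_empty (μ := volume)
    ext u
    simp only [Set.mem_ofPred_eq, Set.mem_empty_iff_false, iff_false, not_lt]
    exact (powerCap_le_one _ _ _).trans (not_lt.1 ht1)

theorem lintegral_powerCap_sq (hq : 1 ≤ q) {β : ℝ} (hβ : 0 < β) (hd : 1 ≤ d) :
    ∫⁻ u : Fin d → ℝ, ENNReal.ofReal (powerCap q β u ^ 2) =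
      ENNReal.ofReal (2 * lqBallVolume q d / ((d / β + 1) * (d / β + 2))) := by
  have hV := lqBallVolume_pos hq d
  have hd0 : (0 : ℝ) < d := by exact_mod_cast hd
  have h := lintegral_rpow_eq_lintegral_meas_lt_mul (volume : Measure (Fin d → ℝ))
    (f := powerCap q β) (ae_of_all _ fun u => powerCap_nonneg q β u)
    (continuous_powerCap hq hβ).aemeasurable (p := 2) two_pos
  simp only [Real.rpow_two] at h
  rw [h]
  have h2 : ∫⁻ t in Set.Ioi (0 : ℝ), volume {u : Fin d → ℝ | t < powerCap q β u} *
      ENNReal.ofReal (t ^ ((2 : ℝ) - 1)) =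
      ∫⁻ t in Set.Ioo (0 : ℝ) 1,
        ENNReal.ofReal (lqBallVolume q d * (t * (1 - t) ^ (d / β))) := by
    rw [← lintegral_indicator measurableSet_Ioi, ← lintegral_indicator measurableSet_Ioo]
    refine lintegral_congr fun t => ?_
    by_cases ht : 0 < t
    · rw [Set.indicator_of_mem (show t ∈ Set.Ioi 0 from ht), volume_lt_powerCap hq hβ hd ht]
      by_cases ht1 : t ∈ Set.Ioo (0 : ℝ) 1
      · rw [Set.indicator_of_mem ht1, Set.indicator_of_mem ht1, ← ENNReal.ofReal_mul
          (mul_nonneg hV.le (Real.rpow_nonneg (by linarith [ht1.2]) _))]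
        congr 1
        norm_num
        ring
      · simp [Set.indicator_of_notMem ht1]
    · rw [Set.indicator_of_notMem (show t ∉ Set.Ioi 0 from ht),
        Set.indicator_of_notMem fun h => ht h.1]
  have hcont : Continuous fun t : ℝ => lqBallVolume q d * (t * (1 - t) ^ (d / β)) :=
    continuous_const.mul (continuous_id.mul
      ((continuous_const.sub continuous_id).rpow_const fun _ => Or.inr (by positivity)))
  rw [h2, ← ofReal_integral_eq_lintegral_ofReal
      ((hcont.integrableOn_Icc (a := 0) (b := 1)).mono_set Set.Ioo_subset_Icc_self),
    ← integral_Ioc_eq_integral_Ioo, ← intervalIntegral.integral_of_le zero_le_one,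
    intervalIntegral.integral_const_mul, integral_mul_one_sub_rpow (by positivity),
    ← ENNReal.ofReal_mul two_pos.le]
  · congr 1
    ring
  · filter_upwards [ae_restrict_mem measurableSet_Ioo] with t ht
    exact mul_nonneg hV.le (mul_nonneg ht.1.le (Real.rpow_nonneg (by linarith [ht.2]) _))

theorem isHolderBump_powerCap (hq : 1 ≤ q) {β : ℝ} (hβ : 0 < β) (hβ1 : β ≤ 1) (hd : 1 ≤ d) :
    IsHolderBump q β (powerCap q β : (Fin d → ℝ) → ℝ)
      (2 * lqBallVolume q d / ((d / β + 1) * (d / β + 2))) where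
  measurable := (continuous_powerCap hq hβ).measurable
  support u hu := by
    refine max_eq_left (sub_nonpos.2 (Real.one_le_rpow ?_ hβ.le))
    exact hu.le.trans (norm_le_lqNorm hq u)
  pos := by have := lqBallVolume_pos hq d; positivity
  lintegral_sq := lintegral_powerCap_sq hq hβ hd
  mem_holder L hL U x₀ h hh hh1 := powerCap_mem_holderClass hq hβ hβ1 hL U x₀ hh hh1

end

/-! ### Smooth bumps for arbitrary `β`. -/

theorem natCast_lt_infty (k : ℕ) : (k : WithTop ℕ∞) < ((⊤ : ℕ∞) : WithTop ℕ∞) := by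
  exact_mod_cast ENat.natCast_lt_top k

theorem natCast_le_infty (k : ℕ) : (k : WithTop ℕ∞) ≤ ((⊤ : ℕ∞) : WithTop ℕ∞) :=
  (natCast_lt_infty k).le

theorem holderOrder_lt {β : ℝ} (hβ : 0 < β) : (holderOrder β : ℝ) < β := by
  have h1 : 0 < ⌈β⌉₊ := Nat.ceil_pos.2 hβ
  refine Nat.lt_ceil.1 ?_
  unfold holderOrder
  omega

theorem sub_holderOrder_le_one {β : ℝ} : β - holderOrder β ≤ 1 := by
  have h1 : β ≤ (⌈β⌉₊ : ℝ) := Nat.le_ceil β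
  have h2 : (⌈β⌉₊ : ℝ) ≤ (holderOrder β : ℝ) + 1 := by
    unfold holderOrder
    exact_mod_cast (by omega : ⌈β⌉₊ ≤ ⌈β⌉₊ - 1 + 1)
  linarith

section

variable {d : ℕ} {q : ℝ} {φ : (Fin d → ℝ) → ℝ}

theorem abs_iteratedFDeriv_single_le {k : ℕ} (j : Fin k → Fin d)
    (m : ContinuousMultilinearMap ℝ (fun _ : Fin k => Fin d → ℝ) ℝ) :
    |m fun i => Pi.single (j i) (1 : ℝ)| ≤ ‖m‖ := by
  have h : ∀ i, ‖(Pi.single (j i) 1 : Fin d → ℝ)‖ = 1 := fun i => by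
    rw [Pi.norm_single, norm_one]
  simpa [h] using m.le_opNorm fun i => Pi.single (j i) (1 : ℝ)

theorem mixedPartial_rescale (hφ : ContDiff ℝ (⊤ : ℕ∞) φ) {k : ℕ} (j : Fin k → Fin d) (c h : ℝ)
    (x₀ x : Fin d → ℝ) :
    mixedPartial j (fun x => c * φ (h⁻¹ • (x - x₀))) x =
      c * (h⁻¹) ^ k * mixedPartial j φ (h⁻¹ • (x - x₀)) := by
  have hk : ContDiff ℝ k φ := hφ.of_le (natCast_le_infty _)
  have h1 : ContDiff ℝ k fun x => φ (h⁻¹ • (x - x₀)) := by fun_prop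
  have h2 : iteratedFDeriv ℝ k (fun x => c * φ (h⁻¹ • (x - x₀))) x =
      c • (h⁻¹) ^ k • iteratedFDeriv ℝ k φ (h⁻¹ • (x - x₀)) := by
    rw [show (fun x => c * φ (h⁻¹ • (x - x₀))) = c • fun x => φ (h⁻¹ • (x - x₀)) from rfl,
      iteratedFDeriv_const_smul_apply h1.contDiffAt,
      iteratedFDeriv_comp_sub (f := fun x => φ (h⁻¹ • x)) k x₀ x,
      iteratedFDeriv_comp_const_smul h⁻¹ hk]
  simp [mixedPartial, h2, mul_assoc]

theorem exists_iteratedFDeriv_bound (hφ : ContDiff ℝ (⊤ : ℕ∞) φ) (hs : HasCompactSupport φ) (N : ℕ) :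
    ∃ C, 0 < C ∧ ∀ k ≤ N, ∀ u, ‖iteratedFDeriv ℝ k φ u‖ ≤ C := by
  have h : ∀ k : ℕ, ∃ C, ∀ u, ‖iteratedFDeriv ℝ k φ u‖ ≤ C := fun k =>
    (hφ.continuous_iteratedFDeriv (natCast_le_infty k)).bounded_above_of_compact_support (hs.iteratedFDeriv k)
  choose C hC using h
  have hC0 : ∀ k, 0 ≤ C k := fun k => (norm_nonneg _).trans (hC k 0)
  refine ⟨1 + ∑ k ∈ Finset.range (N + 1), C k, ?_, fun k hk u => ?_⟩
  · have := Finset.sum_nonneg fun k (_ : k ∈ Finset.range (N + 1)) => hC0 k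
    linarith
  · have := Finset.single_le_sum (f := C) (fun k _ => hC0 k)
      (Finset.mem_range.2 (Nat.lt_succ_of_le hk))
    linarith [hC k u]

/-- At distance at most `1`, the derivative of order `k + 1` gives a Lipschitz bound, and `s ≤ s^γ`.
At larger distances the triangle inequality suffices, whence the factor `2`. -/
theorem abs_mixedPartial_sub_le (hq : 1 ≤ q) (hφ : ContDiff ℝ (⊤ : ℕ∞) φ) {k : ℕ} {C : ℝ}
    (hC : ∀ l ≤ k + 1, ∀ u, ‖iteratedFDeriv ℝ l φ u‖ ≤ C) {γ : ℝ} (hγ : 0 < γ) (hγ1 : γ ≤ 1)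
    (j : Fin k → Fin d) (u v : Fin d → ℝ) :
    |mixedPartial j φ u - mixedPartial j φ v| ≤ 2 * C * lqNorm q (u - v) ^ γ := by
  have hC0 : 0 ≤ C := (norm_nonneg _).trans (hC 0 (Nat.zero_le _) 0)
  have h0 := lqNorm_nonneg q (u - v)
  have h1 : |mixedPartial j φ u - mixedPartial j φ v| ≤
      ‖iteratedFDeriv ℝ k φ u - iteratedFDeriv ℝ k φ v‖ :=
    abs_iteratedFDeriv_single_le j (iteratedFDeriv ℝ k φ u - iteratedFDeriv ℝ k φ v)
  refine h1.trans ?_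
  rcases le_total (lqNorm q (u - v)) 1 with hle | hle
  · have hlip : ‖iteratedFDeriv ℝ k φ u - iteratedFDeriv ℝ k φ v‖ ≤ C * ‖u - v‖ := by
      refine Convex.norm_image_sub_le_of_norm_fderiv_le (𝕜 := ℝ) (s := Set.univ)
        (fun x _ => ?_) (fun x _ => ?_) convex_univ trivial trivial
      · exact (hφ.differentiable_iteratedFDeriv (natCast_lt_infty k)).differentiableAt
      · rw [norm_fderiv_iteratedFDeriv]
        exact hC _ le_rfl x
    have h2 : ‖u - v‖ ≤ lqNorm q (u - v) ^ γ :=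
      (norm_le_lqNorm hq _).trans (Real.self_le_rpow_of_le_one h0 hle hγ1)
    have h3 : 0 ≤ lqNorm q (u - v) ^ γ := Real.rpow_nonneg h0 _
    nlinarith
  · have h2 : (1 : ℝ) ≤ lqNorm q (u - v) ^ γ := Real.one_le_rpow hle hγ.le
    have h3 := norm_sub_le (iteratedFDeriv ℝ k φ u) (iteratedFDeriv ℝ k φ v)
    have h4 := hC k (Nat.le_succ k) u
    have h5 := hC k (Nat.le_succ k) v
    nlinarith

/-- A partial derivative of order `k` costs `h^(-k)`, and `h^(β-k) ≤ 1` for `k ≤ holderOrder β < β`.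
At top order the remaining `h^γ` cancels the rescaling of the Hölder increment, and `(2C)⁻¹` cancels
its constant. -/
theorem smooth_mem_holderClass (hq : 1 ≤ q) (hφ : ContDiff ℝ (⊤ : ℕ∞) φ) {β : ℝ} (hβ : 0 < β) {C : ℝ}
    (hC0 : 0 < C) (hC : ∀ l ≤ holderOrder β + 1, ∀ u, ‖iteratedFDeriv ℝ l φ u‖ ≤ C) {L : ℝ}
    (hL : 0 < L) (U : Set (Fin d → ℝ)) (x₀ : Fin d → ℝ) {h : ℝ} (hh : 0 < h) (hh1 : h ≤ 1) :
    (fun x => L * h ^ β * ((2 * C)⁻¹ * φ (h⁻¹ • (x - x₀)))) ∈ HolderClass q β L U := by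
  have hlt := holderOrder_lt hβ
  simp only [← mul_assoc]
  refine ⟨?_, fun k hk j x _ => ?_, fun j x _ y _ => ?_⟩
  · have hk : ContDiff ℝ (holderOrder β : ℕ) φ := hφ.of_le (natCast_le_infty _)
    exact ContDiff.contDiffOn (by fun_prop)
  · rw [mixedPartial_rescale hφ, abs_mul, abs_of_nonneg (by positivity)]
    have h1 : |mixedPartial j φ (h⁻¹ • (x - x₀))| ≤ C :=
      (abs_iteratedFDeriv_single_le j _).trans (hC k (by omega) _)
    have h2 : h ^ β * (h⁻¹) ^ k ≤ 1 := by
      rw [inv_pow, ← div_eq_mul_inv, ← Real.rpow_natCast h k, ← Real.rpow_sub hh]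
      refine Real.rpow_le_one hh.le hh1 (sub_nonneg.2 ?_)
      exact (Nat.cast_le.2 hk).trans hlt.le
    calc L * h ^ β * (2 * C)⁻¹ * h⁻¹ ^ k * |mixedPartial j φ (h⁻¹ • (x - x₀))|
        ≤ L * h ^ β * (2 * C)⁻¹ * h⁻¹ ^ k * C := by gcongr
      _ = L * (h ^ β * (h⁻¹) ^ k) * (1 / 2) := by field_simp
      _ ≤ L * 1 * 1 := by gcongr; norm_num
      _ = L := by ring
  · rw [mixedPartial_rescale hφ, mixedPartial_rescale hφ, ← mul_sub, abs_mul,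
      abs_of_nonneg (by positivity)]
    set γ := β - (holderOrder β : ℝ) with hγ
    have h1 := abs_mixedPartial_sub_le hq hφ hC (γ := γ) (sub_pos.2 hlt) sub_holderOrder_le_one
      j (h⁻¹ • (x - x₀)) (h⁻¹ • (y - x₀))
    rw [← smul_sub, sub_sub_sub_cancel_right, lqNorm_smul hq, abs_of_pos (inv_pos.2 hh),
      Real.mul_rpow (inv_pos.2 hh).le (lqNorm_nonneg _ _), Real.inv_rpow hh.le] at h1
    have h2 : h ^ β * (h⁻¹) ^ holderOrder β = h ^ γ := by
      rw [inv_pow, ← div_eq_mul_inv, ← Real.rpow_natCast h, ← Real.rpow_sub hh]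
    have h3 : h ^ γ ≠ 0 := by positivity
    refine (mul_le_mul_of_nonneg_left h1 (by positivity)).trans (le_of_eq ?_)
    calc L * h ^ β * (2 * C)⁻¹ * h⁻¹ ^ holderOrder β *
          (2 * C * ((h ^ γ)⁻¹ * lqNorm q (x - y) ^ γ))
        = L * (h ^ β * h⁻¹ ^ holderOrder β) * ((h ^ γ)⁻¹ * lqNorm q (x - y) ^ γ) := by
          field_simp
      _ = L * lqNorm q (x - y) ^ γ := by rw [h2]; field_simp

end

theorem exists_isHolderBump {q : ℝ} (hq : 1 ≤ q) {β : ℝ} (hβ : 0 < β) (d : ℕ) :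
    ∃ (g : (Fin d → ℝ) → ℝ) (B : ℝ), IsHolderBump q β g B ∧ g 0 ≠ 0 := by
  let φ : ContDiffBump (0 : Fin d → ℝ) := ⟨1 / 2, 1, by norm_num, by norm_num⟩
  have hφ : ContDiff ℝ (⊤ : ℕ∞) φ := φ.contDiff
  have hs : HasCompactSupport φ := φ.hasCompactSupport
  obtain ⟨C, hC0, hC⟩ := exists_iteratedFDeriv_bound hφ hs (holderOrder β + 1)
  have hφ0 : φ 0 = 1 := φ.one_of_mem_closedBall (by simp [φ])
  have hcont : Continuous fun u => ((2 * C)⁻¹ * φ u) ^ 2 := by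
    have := hφ.continuous
    fun_prop
  have hcs : HasCompactSupport fun u => ((2 * C)⁻¹ * φ u) ^ 2 :=
    hs.mono fun u hu => by
      rw [Function.mem_support] at hu ⊢
      exact fun h => hu (by simp [h])
  have hnn : ∀ u, 0 ≤ ((2 * C)⁻¹ * φ u) ^ 2 := fun u => sq_nonneg _
  refine ⟨fun u => (2 * C)⁻¹ * φ u, ∫ u, ((2 * C)⁻¹ * φ u) ^ 2, ⟨?_, ?_, ?_, ?_, ?_⟩, ?_⟩
  · have := hφ.continuous.measurable
    fun_prop
  · intro u hu
    rw [φ.zero_of_le_dist (by simpa [φ] using hu.le), mul_zero]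
  · refine hcont.integral_pos_of_hasCompactSupport_nonneg_nonzero hcs hnn (x := 0) ?_
    rw [hφ0]
    positivity
  · rw [ofReal_integral_eq_lintegral_ofReal (hcont.integrable_of_hasCompactSupport hcs)
      (ae_of_all _ hnn)]
  · intro L hL U x₀ h hh hh1
    exact smooth_mem_holderClass hq hφ hβ hC0 hC hL U x₀ hh hh1
  · simp only [hφ0]
    positivity

/-! ### The constants and their ratio. -/

theorem le_liminf_worstCaseMSE_of_bump {d : ℕ} {q : ℝ} {X U : Set (Fin d → ℝ)}
    {PX : Measure (Fin d → ℝ)} {pX : (Fin d → ℝ) → ℝ} {κ : Kernel (Fin d → ℝ) ℝ}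
    {p : (Fin d → ℝ) → ℝ → ℝ} (M : RegularModel q X U PX pX κ p) {β L : ℝ} (hβ : 0 < β)
    (hL : 0 < L) {x₀ : Fin d → ℝ} (hx₀ : x₀ ∈ X)
    {g : (Fin d → ℝ) → ℝ} {B : ℝ} (hg : IsHolderBump q β g B) {a : ℝ} (ha : 0 < a)
    (fhat : (n : ℕ) → RegressionEstimator d n) (hfhat : ∀ n, Measurable fun D => fhat n D x₀) :
    ENNReal.ofReal (g 0 ^ 2 * (a / B) ^ (2 * β / (2 * β + d)) * Real.exp (-a) *
        (L ^ ((d : ℝ) / β) / (pX x₀ * condFisher κ p x₀)) ^ (2 * β / (2 * β + d))) ≤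
      liminf (fun n => worstCaseMSE q β L U PX κ x₀ n (fhat n)) atTop := by
  have hden : 0 < 2 * β + d := by positivity
  have hi0 : 0 ≤ condFisher κ p x₀ := integral_nonneg fun _ => sq_nonneg _
  -- `moments` bounds the Fisher information below only almost everywhere. If it vanished at `x₀`,
  -- the conventions `y / 0 = 0` and `0 ^ r = 0` would make the left side zero.
  rcases hi0.eq_or_lt with hi | hi
  · rw [← hi, mul_zero, div_zero, Real.zero_rpow (by positivity), mul_zero, ENNReal.ofReal_zero]
    exact zero_le
  refine le_trans (le_of_eq ?_)
    (le_liminf_worstCaseMSE M hβ hL (M.subset hx₀) hi hg ha fhat hfhat)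
  obtain ⟨cX, _, hc, hb⟩ := M.covariate_bounds
  have hP : 0 < pX x₀ * condFisher κ p x₀ :=
    mul_pos (hc.trans_le (hb x₀ (M.subset hx₀)).1) hi
  have hB := hg.pos
  set P := pX x₀ * condFisher κ p x₀
  set r := 2 * β / (2 * β + d) with hr
  -- Both sides are `L^(2d/(2β+d))`, as `1 - r = d/(2β+d)`.
  have hLpow : (L ^ ((d : ℝ) / β)) ^ r = L ^ 2 * (L ^ 2) ^ (-r) := by
    rw [← Real.rpow_natCast L 2, ← Real.rpow_mul hL.le, ← Real.rpow_mul hL.le,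
      ← Real.rpow_add hL]
    congr 1
    rw [hr]
    push_cast
    field_simp
    ring
  rw [Real.div_rpow (by positivity) hP.le, hLpow, Real.rpow_neg (by positivity),
    show a / (P * L ^ 2 * B) = a / B / (P * L ^ 2) by field_simp,
    Real.div_rpow (x := a / B) (by positivity) (by positivity),
    Real.mul_rpow hP.le (by positivity)]
  congr 1
  have : P ^ r ≠ 0 := by positivity
  have : (L ^ 2) ^ r ≠ 0 := by positivity
  field_simp

/-- In terms of `r = 2β/(2β+d)` and `B = ∫ powerCap²` this is `(r/B)^r (1-r)^(1-r)`, sharing the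
factor `(r/B)^r` with the lower bound at `a = r`. -/
theorem upperConst_eq {q : ℝ} (hq : 1 ≤ q) {β : ℝ} (hβ : 0 < β) {d : ℕ} (hd : 1 ≤ d) :
    upperConst q β d =
      ((2 * β / (2 * β + d)) / (2 * lqBallVolume q d / ((d / β + 1) * (d / β + 2)))) ^
        (2 * β / (2 * β + d)) * (1 - 2 * β / (2 * β + d)) ^ (1 - 2 * β / (2 * β + d)) := by
  have hd0 : (0 : ℝ) < d := by exact_mod_cast hd
  have hV := lqBallVolume_pos hq d
  have hden : 0 < 2 * β + d := by positivity
  have hG1 : 0 < Real.Gamma (1 / q + 1) := Real.Gamma_pos_of_pos (by positivity)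
  have hGd : 0 < Real.Gamma (d / q + 1) := Real.Gamma_pos_of_pos (by positivity)
  have h1 : (2 * β / (2 * β + d)) / (2 * lqBallVolume q d / ((d / β + 1) * (d / β + 2))) =
      (β + d) / (β * lqBallVolume q d) := by
    field_simp
    ring
  have h2 : 1 - 2 * β / (2 * β + d) = d / (2 * β + d) := by field_simp; ring
  have h3 : ((β + d) / (β * lqBallVolume q d)) ^ (2 * β / (2 * β + d)) =
      (((β + d) / (β * lqBallVolume q d)) ^ (2 * β)) ^ (1 / (2 * β + d)) := by
    rw [← Real.rpow_mul (by positivity)]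
    congr 1
    ring
  have h4 : ((d : ℝ) / (2 * β + d)) ^ ((d : ℝ) / (2 * β + d)) =
      (((d : ℝ) / (2 * β + d)) ^ d) ^ (1 / (2 * β + d)) := by
    rw [← Real.rpow_natCast, ← Real.rpow_mul (by positivity)]
    congr 1
    ring
  rw [h1, h2, h3, h4, ← Real.mul_rpow (by positivity) (by positivity), upperConst]
  congr 1
  rw [← Real.rpow_natCast (2 * β + d), ← Real.rpow_natCast ((d : ℝ) / (2 * β + d)),
    Real.div_rpow hd0.le hden.le, lqBallVolume, add_comm 1 ((d : ℝ) / q), add_comm 1 (1 / q),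
    Real.div_rpow (by positivity) (by positivity), Real.mul_rpow hβ.le (by positivity),
    Real.div_rpow (by positivity) (by positivity), mul_pow, Real.mul_rpow (by positivity)
    (by positivity), Real.mul_rpow (x := 2 ^ d) (by positivity) (by positivity),
    mul_comm (2 * β) (d : ℝ), Real.rpow_mul hG1.le, Real.rpow_natCast, Real.rpow_natCast,
    Real.rpow_natCast]
  field_simp

theorem one_sub_rpow_mul_exp_le {r : ℝ} (hr1 : r < 1) :
    (1 - r) ^ (1 - r) * Real.exp (-r ^ 2) ≤ Real.exp (-r) := by
  have h0 : 0 < 1 - r := by linarith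
  rw [Real.rpow_def_of_pos h0, ← Real.exp_add, Real.exp_le_exp]
  nlinarith [Real.log_le_sub_one_of_pos h0]

theorem upperConst_pos {q : ℝ} (hq : 1 ≤ q) {β : ℝ} (hβ : 0 < β) {d : ℕ} (hd : 1 ≤ d) :
    0 < upperConst q β d := by
  have hd0 : (0 : ℝ) < d := by exact_mod_cast hd
  have hV := lqBallVolume_pos hq d
  rw [upperConst_eq hq hβ hd]
  have h2 : 0 < 1 - 2 * β / (2 * β + d) := by
    rw [sub_pos, div_lt_one (by positivity)]; linarith
  positivity

/-- The lower-bound constant: explicit for `β ≤ 1`, some positive number for `β > 1`. -/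
theorem exists_lowerConst {q : ℝ} (hq : 1 ≤ q) {β : ℝ} (hβ : 0 < β) {d : ℕ} (hd : 1 ≤ d) :
    ∃ c : ℝ, 0 < c ∧
      (β ≤ 1 → c = upperConst q β d * Real.exp (-(2 * β / (2 * β + d)) ^ 2)) ∧
      ∀ L : ℝ, 0 < L →
        ∀ (X U : Set (Fin d → ℝ)) (PX : Measure (Fin d → ℝ)) (pX : (Fin d → ℝ) → ℝ)
          (κ : Kernel (Fin d → ℝ) ℝ) (p : (Fin d → ℝ) → ℝ → ℝ),
          RegularModel q X U PX pX κ p →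
          ∀ x₀ ∈ X, ∀ fhat : (n : ℕ) → RegressionEstimator d n,
            (∀ n, Measurable (fun D => fhat n D x₀)) →
            ENNReal.ofReal (c *
                (L ^ ((d : ℝ) / β) / (pX x₀ * condFisher κ p x₀)) ^ (2 * β / (2 * β + d))) ≤
              liminf (fun n => worstCaseMSE q β L U PX κ x₀ n (fhat n)) atTop := by
  have hd0 : (0 : ℝ) < d := by exact_mod_cast hd
  rcases le_or_gt β 1 with hβ1 | hβ1
  -- The constant is at most the `(r/B)^r exp(-r)` that the method yields; this choice makes the
  -- ratio to `upperConst` exactly `exp(r²)`.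
  · refine ⟨_, mul_pos (upperConst_pos hq hβ hd) (Real.exp_pos _), fun _ => rfl, ?_⟩
    intro L hL X U PX pX κ p M x₀ hx₀ fhat hfhat
    -- `a = r` maximises `a^r exp(-a)`.
    refine le_trans (ENNReal.ofReal_le_ofReal ?_)
      (le_liminf_worstCaseMSE_of_bump M hβ hL hx₀ (isHolderBump_powerCap hq hβ hβ1 hd)
        (a := 2 * β / (2 * β + d)) (by positivity) fhat hfhat)
    rw [powerCap_zero hq hβ, one_pow, one_mul, upperConst_eq hq hβ hd]
    obtain ⟨cX, _, hc, hb⟩ := M.covariate_bounds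
    have hP : 0 ≤ pX x₀ * condFisher κ p x₀ :=
      mul_nonneg (hc.le.trans (hb x₀ (M.subset hx₀)).1) (integral_nonneg fun _ => sq_nonneg _)
    have hV := lqBallVolume_pos hq d
    refine mul_le_mul_of_nonneg_right ?_ (by positivity)
    rw [mul_assoc]
    refine mul_le_mul_of_nonneg_left (one_sub_rpow_mul_exp_le ?_) (by positivity)
    rw [div_lt_one (by positivity)]
    linarith
  · obtain ⟨g, B, hg, hg0⟩ := exists_isHolderBump hq hβ d
    have hB := hg.pos
    refine ⟨g 0 ^ 2 * (1 / B) ^ (2 * β / (2 * β + d)) * Real.exp (-1), by positivity,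
      fun h => absurd h hβ1.not_ge, ?_⟩
    intro L hL X U PX pX κ p M x₀ hx₀ fhat hfhat
    exact le_liminf_worstCaseMSE_of_bump M hβ hL hx₀ hg one_pos fhat hfhat

theorem two_mul_div_le_of_one_le {β : ℝ} (hβ : 0 < β) {d : ℕ} (hd : 1 ≤ d) :
    2 * β / (2 * β + d) ≤ 2 * β / (2 * β + 1) := by
  have hd0 : (1 : ℝ) ≤ d := by exact_mod_cast hd
  gcongr

end

theorem theorem5 (q : ℝ) (hq : 1 ≤ q) :
    ∃ c : ℝ → ℕ → ℝ,
      (∀ β : ℝ, 0 < β → ∀ d : ℕ, 1 ≤ d → 0 < c β d) ∧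
      (∀ β : ℝ, 0 < β → ∀ d : ℕ, 1 ≤ d → ∀ L : ℝ, 0 < L →
        ∀ (X U : Set (Fin d → ℝ)) (PX : Measure (Fin d → ℝ)) (pX : (Fin d → ℝ) → ℝ)
          (κ : Kernel (Fin d → ℝ) ℝ) (p : (Fin d → ℝ) → ℝ → ℝ),
          RegularModel q X U PX pX κ p →
          ∀ x₀ ∈ X, ∀ fhat : (n : ℕ) → RegressionEstimator d n,
            (∀ n, Measurable (fun D => fhat n D x₀)) →
            ENNReal.ofReal (c β d *
                (L ^ ((d : ℝ) / β) / (pX x₀ * condFisher κ p x₀)) ^ (2 * β / (2 * β + d))) ≤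
              liminf (fun n => worstCaseMSE q β L U PX κ x₀ n (fhat n)) atTop) ∧
      Tendsto (fun β : ℝ => ⨆ (d : ℕ) (_ : 1 ≤ d), ENNReal.ofReal (upperConst q β d / c β d))
        (𝓝[>] 0) (𝓝 1) ∧
      1 ≤ (⨆ β ∈ Set.Ioc (0 : ℝ) 1, ⨆ (d : ℕ) (_ : 1 ≤ d),
        ENNReal.ofReal (upperConst q β d / c β d)) ∧
      (⨆ β ∈ Set.Ioc (0 : ℝ) 1, ⨆ (d : ℕ) (_ : 1 ≤ d),
        ENNReal.ofReal (upperConst q β d / c β d)) ≤ ENNReal.ofReal 1.69 := by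
  -- In `exists_lowerConst` the constant precedes `L` and the model, so `c` depends on `β` and `d`
  -- alone for the fixed `q`.
  choose! c hc using fun (β : ℝ) (hβ : 0 < β) (d : ℕ) (hd : 1 ≤ d) =>
    exists_lowerConst hq hβ hd
  have hratio : ∀ β : ℝ, 0 < β → β ≤ 1 → ∀ d : ℕ, 1 ≤ d →
      upperConst q β d / c β d = Real.exp ((2 * β / (2 * β + d)) ^ 2) := by
    intro β hβ hβ1 d hd
    rw [(hc β hβ d hd).2.1 hβ1, div_mul_eq_div_div, div_self (upperConst_pos hq hβ hd).ne',
      one_div, Real.exp_neg, inv_inv]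
  have hone : ∀ β : ℝ, 0 < β → β ≤ 1 →
      1 ≤ ⨆ (d : ℕ) (_ : 1 ≤ d), ENNReal.ofReal (upperConst q β d / c β d) := by
    intro β hβ hβ1
    refine le_trans ?_ (le_iSup₂_of_le 1 le_rfl le_rfl)
    rw [hratio β hβ hβ1 1 le_rfl, ENNReal.one_le_ofReal]
    exact Real.one_le_exp (sq_nonneg _)
  -- The exponent `r` decreases in `d`, so `d = 1` gives a bound uniform in the dimension.
  have hsup : ∀ β : ℝ, 0 < β → β ≤ 1 →
      ⨆ (d : ℕ) (_ : 1 ≤ d), ENNReal.ofReal (upperConst q β d / c β d) ≤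
        ENNReal.ofReal (Real.exp ((2 * β / (2 * β + 1)) ^ 2)) := by
    intro β hβ hβ1
    refine iSup₂_le fun d hd => ?_
    rw [hratio β hβ hβ1 d hd]
    have := two_mul_div_le_of_one_le hβ hd
    gcongr
  refine ⟨c, fun β hβ d hd => (hc β hβ d hd).1, fun β hβ d hd => (hc β hβ d hd).2.2, ?_, ?_, ?_⟩
  · have hlim : Tendsto (fun β : ℝ => ENNReal.ofReal (Real.exp ((2 * β / (2 * β + 1)) ^ 2)))
        (𝓝[>] 0) (𝓝 1) := by
      refine Tendsto.mono_left ?_ nhdsWithin_le_nhds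
      have : ContinuousAt (fun β : ℝ => Real.exp ((2 * β / (2 * β + 1)) ^ 2)) 0 := by
        have h : ContinuousAt (fun β : ℝ => 2 * β / (2 * β + 1)) 0 :=
          ContinuousAt.div (by fun_prop) (by fun_prop) (by norm_num)
        exact (h.pow 2).rexp
      simpa using ENNReal.tendsto_ofReal this.tendsto
    have hev : ∀ᶠ β in 𝓝[>] (0 : ℝ), 0 < β ∧ β ≤ 1 := by
      filter_upwards [Ioc_mem_nhdsGT (zero_lt_one (α := ℝ))] with β h using h
    refine tendsto_of_tendsto_of_tendsto_of_le_of_le' tendsto_const_nhds hlim ?_ ?_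
    · filter_upwards [hev] with β h using hone β h.1 h.2
    · filter_upwards [hev] with β h using hsup β h.1 h.2
  · exact le_iSup₂_of_le (1 : ℝ) ⟨one_pos, le_rfl⟩ (hone 1 one_pos le_rfl)
  · refine iSup₂_le fun β hβ => (hsup β hβ.1 hβ.2).trans (ENNReal.ofReal_le_ofReal ?_)
    have h0 : 0 < β := hβ.1
    -- Hence `r² ≤ 4/9 < 1/2`, and `exp(1/2) < 1.69` because `e < 1.69²`.
    have h1 : 2 * β / (2 * β + 1) ≤ 2 / 3 := by
      rw [div_le_div_iff₀ (by positivity) (by norm_num)]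
      linarith [hβ.2]
    have h2 : 0 ≤ 2 * β / (2 * β + 1) := by positivity
    have h3 : Real.exp ((2 * β / (2 * β + 1)) ^ 2) ≤ Real.exp (1 / 2) :=
      Real.exp_le_exp.2 (by nlinarith)
    have h4 : Real.exp (1 / 2) ^ 2 = Real.exp 1 := by
      rw [← Real.exp_nat_mul]
      norm_num
    have h5 := Real.exp_one_lt_d9
    refine h3.trans (le_of_lt (lt_of_pow_lt_pow_left₀ 2 (by norm_num) ?_))
    rw [h4]
    linarith
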